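/- Let $n\ge 2$ and let $CV_n$ be Culler--Vogtmann Outer Space of rank $n$: marked metric graphs of rank $n$ (finite, connected, all valences at least $3$) up to marked homothety. It is the disjoint union of open simplices, one for each marked graph $G$, consisting of all choices of positive edge lengths on $G$. A face of the simplex of $G$ is a simplex whose marked graph is obtained from $G$ by collapsing some (possibly no) edges without decreasing the rank; a rose-face is a face whose graph has a single vertex, and the edges of this graph are its petals. For a marked metric graph $X$ and a conjugacy class $\gamma$ in $F_n$ let $L_X(\gamma)$ be the length of the geodesic loop representing $\gamma$ in $X$, and let $$d(X,Y)=\log\Big(\sup_\gamma\frac{L_X(\gamma)}{L_Y(\gamma)}\cdot\sup_\gamma\frac{L_Y(\gamma)}{L_X(\gamma)}\Big),$$ the suprema being over nontrivial conjugacy classes. A class $\gamma$ is simple in $G$ if it is represented by an embedded circle in $G$, and almost simple if it is represented by an embedded circle, an embedded figure-eight or an embedded barbell. Let $\Delta_1,\Delta_2$ be simplices of $CV_n$ with underlying marked graphs $G_1,G_2$ and with the same set of rose-faces. Then: 1. A conjugacy class is simple in $G_1$ if and only if it is simple in $G_2$. 2. Let $X_1,X_2\in\Delta_1\cup\Delta_2$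 satisfy $d(X_1,Y)=d(X_2,Y)$ for every point $Y$ of every rose-face of $\Delta_1$. Fix a class $\gamma_0$ that is simple in $G_1$ and choose the representatives of $X_1,X_2$ with $L_{X_1}(\gamma_0)=L_{X_2}(\gamma_0)=1$. Then $L_{X_1}(\gamma)=L_{X_2}(\gamma)$ for every class $\gamma$ that is simple in $G_1$. 3. Every class $\gamma$ that is simple in $G_1$ is represented by a petal of some rose-face of $\Delta_1$. Let $R$ be any rose-face of $\Delta_1$ in which $\gamma$ is represented by a petal $e_0$, let $e\ne e_0$ be another petal of $R$, and for $t>0$ let $Y_t$ be the point of $R$ at which $e$ has length $t$, $e_0$ has length $1/t$, and all other petals have length $1$. Then for every $X\in\Delta_1\cup\Delta_2$ the limit below exists, and $$L_X(\gamma)=C(e,X)\,\lim_{t\to\infty}\frac{e^{d(X,Y_t)}}{t^2},\qquad C(e,X)=\min_{\sigma}\frac{L_X(\sigma)}{n_e(\sigma)}>0,$$ where $\sigma$ ranges over the almost simple classes of the underlying graph of $X$ with $n_e(\sigma)>0$, and $n_e(\sigma)$ is the number of times the geodesic representative of $\sigma$ in $R$ crosses $e$. -/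

import Mathlib

open Filter Topology

noncomputable section

/-! ## Finite graphs and edge paths -/

/-- A finite graph (loops and multiple edges allowed). Every edge `e` carries an arbitrarily chosen
orientation from `src e` to `tgt e`. An oriented edge is a pair `(e, b) : E × Bool`: `(e, true)` is
`e` traversed from `src e` to `tgt e`, and `(e, false)` is the reverse edge. A list of oriented
edges is thus a word in the letters used by `FreeGroup E`. -/
structure FinGraph where
  V : Type
  E : Type
  finV : Finite V
  finE : Finite E
  src : E → V
  tgt : E → V

namespace FinGraph

variable (G : FinGraph)

/-- Initial vertex of an oriented edge. -/
def start (a : G.E × Bool) : G.V := if a.2 then G.src a.1 else G.tgt a.1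

/-- Terminal vertex of an oriented edge. -/
def finish (a : G.E × Bool) : G.V := if a.2 then G.tgt a.1 else G.src a.1

/-- `G.IsPath u p v`: the list `p` of oriented edges is an edge path from `u` to `v`. -/
def IsPath : G.V → List (G.E × Bool) → G.V → Prop
  | u, [], v => u = v
  | u, a :: p, v => G.start a = u ∧ IsPath (G.finish a) p v

variable {G}

theorem IsPath.append {u v w : G.V} {p q : List (G.E × Bool)} (hp : G.IsPath u p v)
    (hq : G.IsPath v q w) : G.IsPath u (p ++ q) w := by
  induction p generalizing u with
  | nil => cases (show u = v from hp); exact hq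
  | cons a p ih => exact ⟨hp.1, ih hp.2⟩

theorem IsPath.invRev {u v : G.V} {p : List (G.E × Bool)} (hp : G.IsPath u p v) :
    G.IsPath v (FreeGroup.invRev p) u := by
  induction p generalizing u with
  | nil => exact (show u = v from hp).symm
  | cons a p ih =>
    rw [FreeGroup.invRev_cons]
    refine (ih hp.2).append ?_
    obtain ⟨e, b⟩ := a
    have h := hp.1
    cases b <;> exact ⟨rfl, h⟩

variable (G)

/-- The fundamental group of `G` at `v`: edge loops at `v` modulo insertion and deletion of
backtracks `a a⁻¹`. Since deleting a backtrack from an edge path leaves an edge path, this is the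
subgroup of the free group on all edges consisting of the elements represented by edge loops
at `v`. -/
def fundGroup (v : G.V) : Subgroup (FreeGroup G.E) where
  carrier := {g | ∃ p, G.IsPath v p v ∧ FreeGroup.mk p = g}
  one_mem' := ⟨[], rfl, rfl⟩
  mul_mem' := by
    rintro _ _ ⟨p, hp, rfl⟩ ⟨q, hq, rfl⟩
    exact ⟨p ++ q, hp.append hq, FreeGroup.mul_mk.symm⟩
  inv_mem' := by
    rintro _ ⟨p, hp, rfl⟩
    exact ⟨FreeGroup.invRev p, hp.invRev, FreeGroup.inv_mk.symm⟩

/-- Number of germs of edges at `v` (a loop at `v` counts twice). -/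
def valence (v : G.V) : ℕ := Nat.card {a : G.E × Bool // G.start a = v}

/-- `p` is a simple closed curve based at `v`: an embedded circle, that is, a nonempty closed edge
path with no repeated vertex and no repeated edge. -/
def IsSimpleClosedPath (v : G.V) (p : List (G.E × Bool)) : Prop :=
  p ≠ [] ∧ G.IsPath v p v ∧ (p.map G.start).Nodup ∧ (p.map Prod.fst).Nodup

/-- `α`, `s`, `β` form an embedded barbell `O—O` (an embedded figure-eight if `s` is the trivial
path): `α` and `β` are simple closed curves based at `u` and `v`, `s` is a path from `u` to `v`, and
no vertex and no edge is repeated, except that `s` ends at the base points. -/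
def IsEmbeddedBarbell (u v : G.V) (α s β : List (G.E × Bool)) : Prop :=
  G.IsSimpleClosedPath u α ∧ G.IsPath u s v ∧ G.IsSimpleClosedPath v β ∧
    (α.map G.start ++ s.map G.finish ++ (β.map G.start).tail).Nodup ∧
    ((α ++ s ++ β).map Prod.fst).Nodup

end FinGraph

/-! ## Marked graphs, and simplices of Outer Space -/

/-- A marked graph of rank `n`: a finite connected graph, all of whose vertices have valence at
least three, with an isomorphism from the free group of rank `n` onto its fundamental group at some
base point. It is the underlying marked graph of a simplex of `CV_n`, and every simplex of `CV_n`
has such an underlying graph. -/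
structure MarkedGraph (n : ℕ) extends FinGraph where
  connected : ∀ u v : V, ∃ p, toFinGraph.IsPath u p v
  three_le_valence : ∀ v : V, 3 ≤ toFinGraph.valence v
  base : V
  mark : FreeGroup (Fin n) →* FreeGroup E
  mark_injective : Function.Injective mark
  mark_range : mark.range = toFinGraph.fundGroup base

/-- `C : Collapse G H` exhibits `H` as the graph obtained from `G` by collapsing a (possibly empty)
set of edges, those sent to `none`: an edge that is not collapsed is sent to an oriented edge of
`H`, every edge of `H` comes from exactly one edge of `G`, and two vertices of `G` are identified in
`H` exactly if they are joined by a path of collapsed edges. -/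
structure Collapse (G H : FinGraph) where
  onV : G.V → H.V
  onE : G.E → Option (H.E × Bool)
  map_edge : ∀ e a, onE e = some a → H.start a = onV (G.src e) ∧ H.finish a = onV (G.tgt e)
  map_collapsed : ∀ e, onE e = none → onV (G.src e) = onV (G.tgt e)
  edge_bij : ∀ e' : H.E, ∃! e, ∃ b, onE e = some (e', b)
  surj : Function.Surjective onV
  fiber : ∀ u v, onV u = onV v → ∃ p, G.IsPath u p v ∧ ∀ a ∈ p, onE a.1 = none

/-- The map induced by a collapse on homotopy classes of edge paths. -/
def Collapse.hom {G H : FinGraph} (C : Collapse G H) : FreeGroup G.E →* FreeGroup H.E :=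
  FreeGroup.lift fun e => match C.onE e with
    | none => 1
    | some a => FreeGroup.mk [a]

namespace MarkedGraph

variable {n : ℕ}

/-- The collapse `C` carries the marking of `G` to that of `H` up to free homotopy (`p` is the track
of the base point). -/
def Respects {G H : MarkedGraph n} (C : Collapse G.toFinGraph H.toFinGraph) : Prop :=
  ∃ p, H.IsPath H.base p (C.onV G.base) ∧
    ∀ w, H.mark w = FreeGroup.mk p * C.hom (G.mark w) * (FreeGroup.mk p)⁻¹

/-- `H` is (the underlying marked graph of) a face of the simplex with underlying marked graph `G`:
it is obtained from `G` by collapsing some edges. As `H` is marked of rank `n`, the rank does not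
drop. -/
def IsFace (H G : MarkedGraph n) : Prop :=
  ∃ C : Collapse G.toFinGraph H.toFinGraph, Respects C

/-- `G` and `H` are the same marked topological graph (so they define the same simplex): there is a
homeomorphism between them that respects the markings up to free homotopy. -/
def Equivalent (G H : MarkedGraph n) : Prop :=
  ∃ C : Collapse G.toFinGraph H.toFinGraph, (∀ e, C.onE e ≠ none) ∧ Respects C

/-- A rose: a graph with exactly one vertex. -/
def IsRose (G : MarkedGraph n) : Prop := ∀ v : G.V, v = G.base

/-- The rose-faces of the simplex with underlying marked graph `G`. -/
def roseFaces (G : MarkedGraph n) : Set (MarkedGraph n) := {R | R.IsRose ∧ R.IsFace G}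

/-- The conjugacy class of `w` is represented in `G` by the closed edge path `p`. (Two closed edge
paths of a connected graph are freely homotopic exactly if they are conjugate in the free group on
the edges.) -/
def Represents (G : MarkedGraph n) (p : List (G.E × Bool)) (w : FreeGroup (Fin n)) : Prop :=
  IsConj (FreeGroup.mk p) (G.mark w)

/-- The conjugacy class of `w` is represented by a simple closed curve in `G`. -/
def IsSimpleLoop (G : MarkedGraph n) (w : FreeGroup (Fin n)) : Prop :=
  ∃ v p, G.IsSimpleClosedPath v p ∧ G.Represents p w

/-- The conjugacy class of `w` is represented by an almost simple closed curve in `G`: a simple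
closed curve, a figure-eight curve or a barbell curve. -/
def IsAlmostSimpleLoop (G : MarkedGraph n) (w : FreeGroup (Fin n)) : Prop :=
  G.IsSimpleLoop w ∨ ∃ u v α s β, G.IsEmbeddedBarbell u v α s β ∧
    G.Represents (α ++ s ++ β ++ FreeGroup.invRev s) w

/-- The conjugacy class of `w` is represented by the edge `e` (in one of its two directions); for a
rose this says that `w` corresponds to the petal `e`. -/
def IsPetalLoop (G : MarkedGraph n) (e : G.E) (w : FreeGroup (Fin n)) : Prop :=
  G.Represents [(e, true)] w ∨ G.Represents [(e, false)] w

open Classical in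
/-- The geodesic representative in `G` of the conjugacy class of `w`, as a cyclic edge path without
backtracking. -/
def geodesic (G : MarkedGraph n) (w : FreeGroup (Fin n)) : List (G.E × Bool) :=
  FreeGroup.reduceCyclically (G.mark w).toWord

open Classical in
/-- The number of times the geodesic representative in `G` of the class of `w` crosses the
edge `e`. -/
def crossings (G : MarkedGraph n) (e : G.E) (w : FreeGroup (Fin n)) : ℕ :=
  ((G.geodesic w).map Prod.fst).count e

end MarkedGraph

/-! ## Points of Outer Space and the symmetric Lipschitz distance -/

/-- A marked metric graph of rank `n`. The points of `CV_n` are the marked metric graphs up to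
marked homothety; as usual a point is given by a representative, not necessarily normalised. -/
structure MarkedMetricGraph (n : ℕ) where
  graph : MarkedGraph n
  len : graph.E → ℝ
  len_pos : ∀ e, 0 < len e

/-- The open simplex with underlying marked graph `G`: all representatives of its points. -/
def MarkedGraph.simplex {n : ℕ} (G : MarkedGraph n) : Set (MarkedMetricGraph n) :=
  {X | G.Equivalent X.graph}

namespace MarkedMetricGraph

variable {n : ℕ}

/-- The length `L_X(w)` of the geodesic representative in `X` of the conjugacy class of `w`. -/
def loopLen (X : MarkedMetricGraph n) (w : FreeGroup (Fin n)) : ℝ :=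
  ((X.graph.geodesic w).map fun a => X.len a.1).sum

/-- The stretching factor `sup_γ L_X(γ) / L_Y(γ)` over all nontrivial loops. -/
def stretch (X Y : MarkedMetricGraph n) : ℝ :=
  ⨆ w : {w : FreeGroup (Fin n) // w ≠ 1}, X.loopLen w / Y.loopLen w

/-- The symmetric bi-Lipschitz distance
`d(X, Y) = log (sup_γ L_X(γ) / L_Y(γ) * sup_γ L_Y(γ) / L_X(γ))`, which is scale invariant. -/
def lipDist (X Y : MarkedMetricGraph n) : ℝ := Real.log (X.stretch Y * Y.stretch X)

end MarkedMetricGraph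

open Classical in
/-- The point `Y_t` (`t > 0`) of the simplex of `R`: the edge `e` has length `t`, the edge `e₀` has
length `1 / t`, and all other edges have length `1`. (For `t ≤ 0`, which plays no role as
`t → ∞`, all lengths are set to `1`.) -/
def MarkedGraph.ray {n : ℕ} (R : MarkedGraph n) (e e₀ : R.E) (t : ℝ) : MarkedMetricGraph n where
  graph := R
  len a := if t ≤ 0 then 1 else if a = e then t else if a = e₀ then 1 / t else 1
  len_pos a := by
    by_cases ht : t ≤ 0
    · simp [ht]
    · have ht' : 0 < t := not_le.mp ht
      simp only [ht, if_false]
      split_ifs <;> positivity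

end

/-! A circle of `G` minus one edge is an arc, hence a forest, and extends to a spanning tree;
collapsing that tree turns the circle into a petal. Conversely a petal lifts to its edge closed up
by an arc of collapsed edges. So the simple loops are exactly the petals of rose-faces
(`exists_rose_petal`, `isSimpleLoop_of_petal`), which gives the first claim.

The limit is a computation of two stretching factors. For large `t` the loop most stretched from
`Y_t` to `X` is the short petal, with factor `t * L_X(γ)`. From `X` to `Y_t` the factor is `t` times
the maximum of `n_e / L_X`, up to a bounded error. Hence `exp d / t ^ 2` tends to `L_X(γ) / C`,
where `C` is the infimum of `L_X / n_e` over all loops crossing `e` (`tendsto_lipDist_ray`).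

That almost simple loops realise this infimum is `mul_crossings_le_loopLen`. Cut a geodesic at its
crossings of an edge `k`. A piece between two crossings in the same direction closes up through `k`
to a loop containing a circle through `k`. A piece between opposite crossings is a turn at one end
of `k` and contains a lollipop there; turns at the two ends alternate, and two lollipops at opposite
ends form a barbell with `k`, or meet and yield two circles through `k`. A potential on the two
directions of `k` does the pairing of turns.

For the second claim, equal distances make `L_{X₁} / L_{X₂}` equal to a ratio of constants depending
on `e` only, at every petal other than `e` (`loopLen_mul_eq`). In rank at least three, any two
petals of a rose leave room for a third one `e`, so the ratio is constant on each rose, and edge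
exchanges between spanning trees connect all simple loops (`IsSimpleLoop.induction`). In rank two
there is no third petal. There the constant is attained at a simple loop, so every simple loop has
one of another class modulo two with at least its ratio, and one with at most its ratio. The ratio
depends only on the class modulo two, and with three nonzero classes it must be constant
(`eq_of_three_classes`). -/

/-! ## Weighted word lengths and translation lengths in free groups -/

namespace FreeGroup

variable {α β : Type*}

/-- The total weight of a word, for weights on the letters that ignore orientation. -/
def weight (f : α → ℝ) (p : List (α × Bool)) : ℝ := (p.map fun a => f a.1).sum

section weight

variable (f : α → ℝ)

@[simp] theorem weight_nil : weight f [] = 0 := by simp [weight]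

@[simp] theorem weight_cons (a : α × Bool) (p : List (α × Bool)) :
    weight f (a :: p) = f a.1 + weight f p := by simp [weight]

@[simp] theorem weight_append (p q : List (α × Bool)) :
    weight f (p ++ q) = weight f p + weight f q := by simp [weight]

@[simp] theorem weight_invRev (p : List (α × Bool)) : weight f (invRev p) = weight f p := by
  induction p with
  | nil => simp
  | cons a p ih => rw [invRev_cons, weight_append, ih]; simp [invRev, add_comm]

theorem weight_flatten_replicate (n : ℕ) (p : List (α × Bool)) :
    weight f (List.replicate n p).flatten = n * weight f p := by
  induction n with
  | zero => simp
  | succ n ih => rw [List.replicate_succ, List.flatten_cons, weight_append, ih]; push_cast; ring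

variable {f}

theorem weight_nonneg (hf : ∀ a, 0 ≤ f a) (p : List (α × Bool)) : 0 ≤ weight f p := by
  apply List.sum_nonneg
  simp only [List.mem_map, forall_exists_index, and_imp]
  rintro _ a _ rfl
  exact hf _

theorem weight_pos (hf : ∀ a, 0 < f a) {p : List (α × Bool)} (hp : p ≠ []) : 0 < weight f p := by
  cases p with
  | nil => exact absurd rfl hp
  | cons a p =>
    rw [weight_cons]
    linarith [hf a.1, weight_nonneg (fun a => (hf a).le) p]

theorem weight_mono {g : α → ℝ} (h : ∀ a, f a ≤ g a) (p : List (α × Bool)) :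
    weight f p ≤ weight g p := by
  induction p with
  | nil => simp
  | cons a p ih => simpa using add_le_add (h a.1) ih

theorem weight_le_of_sublist (hf : ∀ a, 0 ≤ f a) {p q : List (α × Bool)} (h : p.Sublist q) :
    weight f p ≤ weight f q := by
  induction h with
  | slnil => simp
  | cons a _ ih => rw [weight_cons]; linarith [hf a.1]
  | cons_cons a _ ih => rw [weight_cons, weight_cons]; linarith

theorem weight_congr_of_perm {p q : List (α × Bool)} (h : (p.map Prod.fst).Perm (q.map Prod.fst)) :
    weight f p = weight f q := by
  have key : ∀ p : List (α × Bool), weight f p = ((p.map Prod.fst).map f).sum := fun p => by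
    rw [weight, List.map_map]; rfl
  rw [key, key, (h.map f).sum_eq]

theorem weight_linear (g : α → ℝ) (c d : ℝ) (p : List (α × Bool)) :
    weight (fun a => c * f a + d * g a) p = c * weight f p + d * weight g p := by
  induction p with
  | nil => simp
  | cons a p ih => simp only [weight_cons, ih]; ring

end weight

/-! ### Reduced and cyclically reduced words -/

section reduced

theorem isReduced_of_nodup {p : List (α × Bool)} (h : (p.map Prod.fst).Nodup) : IsReduced p := by
  refine List.Pairwise.isChain ((List.pairwise_map.1 h).imp ?_)
  intro a b hab h'
  exact absurd h' hab

theorem isCyclicallyReduced_of_nodup {p : List (α × Bool)} (h : (p.map Prod.fst).Nodup) :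
    IsCyclicallyReduced p := by
  refine ⟨isReduced_of_nodup h, fun a ha b hb hab => ?_⟩
  have := List.inj_on_of_nodup_map h (List.mem_of_getLast? ha) (List.mem_of_head? hb) hab
  rw [this]

theorem IsCyclicallyReduced.append_self {p : List (α × Bool)} (h : IsCyclicallyReduced p) :
    IsReduced (p ++ p) := by
  simpa [List.replicate] using (h.flatten_replicate 2).isReduced

theorem isCyclicallyReduced_of_append_self {p : List (α × Bool)} (h : IsReduced (p ++ p)) :
    IsCyclicallyReduced p := by
  rw [IsReduced, List.isChain_append] at h
  exact ⟨h.1, h.2.2⟩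

theorem isReduced_invRev {p : List (α × Bool)} (h : IsReduced p) : IsReduced (invRev p) := by
  classical
  rw [isReduced_iff_reduce_eq, reduce_invRev, h.reduce_eq]

theorem IsReduced.eq_of_mk_eq {p q : List (α × Bool)} (hp : IsReduced p) (hq : IsReduced q)
    (h : mk p = mk q) : p = q := by
  classical
  rw [← hp.reduce_eq, ← hq.reduce_eq, ← toWord_mk, ← toWord_mk, h]

theorem mem_invRev {p : List (α × Bool)} {a : α × Bool} : a ∈ invRev p ↔ (a.1, !a.2) ∈ p := by
  simp only [invRev, List.mem_reverse, List.mem_map, Prod.exists]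
  constructor
  · rintro ⟨x, b, h, rfl⟩; simpa using h
  · intro h; exact ⟨_, _, h, by simp⟩

theorem map_fst_invRev (p : List (α × Bool)) :
    (invRev p).map Prod.fst = (p.map Prod.fst).reverse := by
  simp [invRev, List.map_map, Function.comp_def]

end reduced

/-! ### Word norms, translation lengths and their behaviour under homomorphisms -/

section lengths

open Classical

/-- The weight of the reduced word representing `g`. -/
noncomputable def wordNorm (f : α → ℝ) (g : FreeGroup α) : ℝ := weight f g.toWord

/-- The weight of the cyclically reduced words representing the conjugacy class of `g`. -/
noncomputable def transLen (f : α → ℝ) (g : FreeGroup α) : ℝ :=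
  weight f (reduceCyclically g.toWord)

theorem reduceCyclically_eq_self {p : List (α × Bool)} (h : IsCyclicallyReduced p) :
    reduceCyclically p = p := by
  induction p using List.bidirectionalRec
  case nil => simp
  case singleton => simp
  case cons_append a l b _ =>
    rw [reduceCyclically.cons_append, if_neg]
    · rfl
    · have := isCyclicallyReduced_cons_append_iff.1 h
      rintro ⟨h1, h2⟩
      have := this.2 h1
      rw [← h2] at this
      simp at this

theorem isConj_mk_reduceCyclically (g : FreeGroup α) :
    IsConj (mk (reduceCyclically g.toWord)) g := by
  rw [isConj_iff]
  refine ⟨mk (reduceCyclically.conjugator g.toWord), ?_⟩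
  rw [inv_mk, mul_mk, mul_mk, reduceCyclically.conj_conjugator_reduceCyclically, mk_toWord]

theorem reduceCyclically_toWord_ne_nil {g : FreeGroup α} (hg : g ≠ 1) :
    reduceCyclically g.toWord ≠ [] := by
  intro h
  have := isConj_mk_reduceCyclically g
  rw [h, ← one_eq_mk, isConj_one_right] at this
  exact hg this

variable {f : α → ℝ}

theorem transLen_mk (f : α → ℝ) {p : List (α × Bool)} (h : IsCyclicallyReduced p) :
    transLen f (mk p) = weight f p := by
  rw [transLen, toWord_mk, h.isReduced.reduce_eq, reduceCyclically_eq_self h]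

@[simp] theorem wordNorm_one (f : α → ℝ) : wordNorm f 1 = 0 := by simp [wordNorm]

theorem wordNorm_mk_le (hf : ∀ a, 0 ≤ f a) (p : List (α × Bool)) :
    wordNorm f (mk p) ≤ weight f p := by
  rw [wordNorm, toWord_mk]
  exact weight_le_of_sublist hf reduce.red.sublist

theorem wordNorm_mul_le (hf : ∀ a, 0 ≤ f a) (g h : FreeGroup α) :
    wordNorm f (g * h) ≤ wordNorm f g + wordNorm f h := by
  rw [wordNorm, wordNorm, wordNorm, ← weight_append]
  exact weight_le_of_sublist hf (toWord_mul_sublist g h)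

@[simp] theorem wordNorm_inv (f : α → ℝ) (g : FreeGroup α) :
    wordNorm f g⁻¹ = wordNorm f g := by
  rw [wordNorm, wordNorm, toWord_inv, weight_invRev]

theorem wordNorm_pow (f : α → ℝ) (g : FreeGroup α) (n : ℕ) :
    wordNorm f (g ^ (n + 1)) =
      (n + 1) * transLen f g + 2 * weight f (reduceCyclically.conjugator g.toWord) := by
  rw [wordNorm, toWord_pow, reduceCyclically.reduce_flatten_replicate_succ isReduced_toWord,
    weight_append, weight_append, weight_invRev, weight_flatten_replicate, transLen]
  push_cast
  ring

theorem transLen_le_wordNorm (hf : ∀ a, 0 ≤ f a) (g : FreeGroup α) :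
    transLen f g ≤ wordNorm f g := by
  have h := wordNorm_pow f g 0
  have h' := weight_nonneg hf (reduceCyclically.conjugator g.toWord)
  simp only [zero_add, pow_one, Nat.cast_zero, one_mul] at h
  linarith

/-- Translation length is the growth rate of the norm of powers, and conjugation changes the norms
of all powers by at most a fixed constant. -/
theorem transLen_le_of_isConj (hf : ∀ a, 0 ≤ f a) {g h : FreeGroup α} (hgh : IsConj g h) :
    transLen f g ≤ transLen f h := by
  obtain ⟨c, rfl⟩ := isConj_iff.1 hgh
  by_contra! hlt
  set K := 2 * wordNorm f c + 2 * weight f (reduceCyclically.conjugator (c * g * c⁻¹).toWord)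
  obtain ⟨n, hn⟩ := exists_nat_gt (K / (transLen f g - transLen f (c * g * c⁻¹)))
  rw [div_lt_iff₀ (by linarith)] at hn
  have h1 := wordNorm_pow f g n
  have h2 := wordNorm_pow f (c * g * c⁻¹) n
  have h3 : g ^ (n + 1) = c⁻¹ * (c * g * c⁻¹) ^ (n + 1) * c := by
    rw [conj_pow]; group
  have h4 : wordNorm f (g ^ (n + 1)) ≤
      wordNorm f c + wordNorm f ((c * g * c⁻¹) ^ (n + 1)) + wordNorm f c := by
    rw [h3]
    refine (wordNorm_mul_le hf _ _).trans ?_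
    have := wordNorm_mul_le hf c⁻¹ ((c * g * c⁻¹) ^ (n + 1))
    rw [wordNorm_inv] at this
    linarith
  have h5 := weight_nonneg hf (reduceCyclically.conjugator g.toWord)
  simp only [K] at hn
  nlinarith

/-- Translation length is a conjugacy invariant. -/
theorem transLen_eq_of_isConj (hf : ∀ a, 0 ≤ f a) {g h : FreeGroup α} (hgh : IsConj g h) :
    transLen f g = transLen f h :=
  le_antisymm (transLen_le_of_isConj hf hgh) (transLen_le_of_isConj hf hgh.symm)

theorem wordNorm_map_le (hf : ∀ a, 0 ≤ f a) (Ψ : FreeGroup β →* FreeGroup α)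
    (p : List (β × Bool)) :
    wordNorm f (Ψ (mk p)) ≤ weight (fun e => wordNorm f (Ψ (of e))) p := by
  induction p with
  | nil => simp [← one_eq_mk]
  | cons a p ih =>
    obtain ⟨e, b⟩ := a
    have h1 : (mk ((e, b) :: p) : FreeGroup β) = mk [(e, b)] * mk p := by rw [mul_mk]; rfl
    have h2 : wordNorm f (Ψ (mk [(e, b)])) = wordNorm f (Ψ (of e)) := by
      cases b
      · have : (mk [(e, false)] : FreeGroup β) = (of e)⁻¹ := by simp [of, inv_mk, invRev]
        rw [this, _root_.map_inv, wordNorm_inv]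
      · rfl
    rw [h1, _root_.map_mul, weight_cons, ← h2]
    exact (wordNorm_mul_le hf _ _).trans (by linarith)

/-- A homomorphism of free groups stretches translation lengths at most as much as it stretches
the generators. -/
theorem transLen_map_le (hf : ∀ a, 0 ≤ f a) (Ψ : FreeGroup β →* FreeGroup α)
    (g : FreeGroup β) :
    transLen f (Ψ g) ≤ transLen (fun e => wordNorm f (Ψ (of e))) g := by
  rw [← transLen_eq_of_isConj hf (Ψ.map_isConj (isConj_mk_reduceCyclically g))]
  exact (transLen_le_wordNorm hf _).trans (wordNorm_map_le hf Ψ _)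

end lengths

/-! ### Letter counts modulo two -/

section parity

/-- The number of occurrences of the letter `a`, modulo two. -/
noncomputable def parity (a : α) : FreeGroup α →* Multiplicative (ZMod 2) :=
  open Classical in lift fun e => Multiplicative.ofAdd (if e = a then 1 else 0)

open Classical in
theorem parity_mk (a : α) (p : List (α × Bool)) :
    parity a (mk p) = Multiplicative.ofAdd (((p.map Prod.fst).count a : ℕ) : ZMod 2) := by
  induction p with
  | nil => simp [← one_eq_mk]
  | cons x p ih =>
    obtain ⟨e, b⟩ := x
    have h1 : (mk ((e, b) :: p) : FreeGroup α) = mk [(e, b)] * mk p := by rw [mul_mk]; rfl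
    have h2 : parity a (mk [(e, b)]) = Multiplicative.ofAdd (if e = a then 1 else 0) := by
      have h3 : parity a (of e) = Multiplicative.ofAdd (if e = a then 1 else 0) := by
        simp [parity]
      cases b
      · have : (mk [(e, false)] : FreeGroup α) = (of e)⁻¹ := by simp [of, inv_mk, invRev]
        rw [this, _root_.map_inv, h3, ← ofAdd_neg]
        congr 1
        split_ifs <;> decide
      · exact h3
    rw [h1, _root_.map_mul, ih, h2, ← ofAdd_add]
    by_cases h : e = a <;> simp [h, add_comm]

/-- A homomorphism to the group of order two is the product of the parities of those letters on
which it is nontrivial. -/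
theorem eq_of_parity_eq [Finite α] (φ : FreeGroup α →* Multiplicative (ZMod 2))
    {x y : FreeGroup α} (h : ∀ a, parity a x = parity a y) : φ x = φ y := by
  classical
  cases nonempty_fintype α
  have key : φ = ∏ a, (parity a) ^ (Multiplicative.toAdd (φ (of a))).val := by
    ext e
    simp only [MonoidHom.finsetProd_apply, MonoidHom.pow_apply]
    rw [Finset.prod_eq_single e]
    · simp [parity, ← ofAdd_nsmul]
    · intro b _ hb
      simp [parity, Ne.symm hb]
    · simp
  rw [key]
  simp [h]

end parity

end FreeGroup

/-! ## Arcs, circles and lollipops in finite graphs -/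

namespace FinGraph

open FreeGroup

variable {G : FinGraph} {u v w : G.V} {p q : List (G.E × Bool)}

theorem isPath_nil : G.IsPath u [] v ↔ u = v := Iff.rfl

theorem isPath_append :
    G.IsPath u (p ++ q) w ↔ ∃ v, G.IsPath u p v ∧ G.IsPath v q w := by
  refine ⟨fun h => ?_, fun ⟨v, h1, h2⟩ => h1.append h2⟩
  induction p generalizing u with
  | nil => exact ⟨u, rfl, h⟩
  | cons a p ih =>
    obtain ⟨v, h1, h2⟩ := ih h.2
    exact ⟨v, ⟨h.1, h1⟩, h2⟩

@[simp] theorem start_not (e : G.E) (b : Bool) : G.start (e, !b) = G.finish (e, b) := by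
  cases b <;> rfl

@[simp] theorem finish_not (e : G.E) (b : Bool) : G.finish (e, !b) = G.start (e, b) := by
  cases b <;> rfl

theorem IsPath.end_unique (h : G.IsPath u p v) (h' : G.IsPath u p w) : v = w := by
  induction p generalizing u with
  | nil => exact h.symm.trans h'
  | cons a p ih => exact ih h.2 h'.2

theorem IsPath.of_red (h : G.IsPath u p v) (hpq : Red p q) : G.IsPath u q v := by
  induction hpq with
  | refl => exact h
  | tail _ hstep ih =>
    cases hstep with
    | not =>
      obtain ⟨x, h1, h2, h3, h4⟩ := isPath_append.1 ih
      refine h1.append ?_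
      rw [finish_not, h2] at h4
      exact h4

open Classical in
theorem IsPath.reduce (h : G.IsPath u p v) : G.IsPath u (FreeGroup.reduce p) v :=
  h.of_red reduce.red

theorem IsPath.cons_map_finish (h : G.IsPath u p v) :
    u :: p.map G.finish = p.map G.start ++ [v] := by
  induction p generalizing u with
  | nil => simp [isPath_nil.1 h]
  | cons a p ih => simp [← ih h.2, h.1]

theorem IsPath.finish_mem (h : G.IsPath u p v) {a : G.E × Bool} (ha : a ∈ p) :
    G.finish a ∈ p.map G.start ++ [v] := by
  rw [← h.cons_map_finish]
  exact List.mem_cons_of_mem _ (List.mem_map_of_mem ha)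

theorem IsPath.start_mem (h : G.IsPath u p v) : u ∈ p.map G.start ++ [v] := by
  rw [← h.cons_map_finish]
  exact List.mem_cons_self

theorem map_finish_invRev (p : List (G.E × Bool)) :
    (invRev p).map G.finish = (p.map G.start).reverse := by
  simp [invRev, Function.comp_def]

/-- Both end points of an edge of a closed path are vertices of that path. -/
theorem IsPath.endpoint_mem (h : G.IsPath u p v) {a b : G.E × Bool} (ha : a ∈ p)
    (hab : a.1 = b.1) : G.start b ∈ p.map G.start ++ [v] := by
  obtain ⟨e, s⟩ := a
  obtain ⟨e', s'⟩ := b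
  obtain rfl : e = e' := hab
  by_cases hs : s = s'
  · subst hs
    exact List.mem_append_left _ (List.mem_map_of_mem ha)
  · obtain rfl : s' = !s := by revert hs; cases s <;> cases s' <;> simp
    rw [start_not]
    exact h.finish_mem ha

theorem nodup_edges_of_arc (h : G.IsPath u p v) (hn : (p.map G.start ++ [v]).Nodup) :
    (p.map Prod.fst).Nodup := by
  induction p generalizing u with
  | nil => simp
  | cons a p ih =>
    rw [List.map_cons, List.cons_append, List.nodup_cons] at hn
    rw [List.map_cons, List.nodup_cons]
    refine ⟨fun hmem => ?_, ih h.2 hn.2⟩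
    obtain ⟨b, hb, hba⟩ := List.mem_map.1 hmem
    exact hn.1 (h.2.endpoint_mem hb hba)

/-- The end point may repeat here, unlike for an arc. An edge repeated in the same direction repeats
its start; repeated in the opposite direction it starts where the first occurrence ends, so it is
the very next edge, a backtrack. -/
theorem nodup_edges_of_isReduced (h : G.IsPath u p v) (hr : IsReduced p)
    (hn : (p.map G.start).Nodup) : (p.map Prod.fst).Nodup := by
  induction p generalizing u with
  | nil => simp
  | cons a p ih =>
    have hn' := hn
    rw [List.map_cons, List.nodup_cons] at hn
    rw [List.map_cons, List.nodup_cons]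
    refine ⟨fun hmem => ?_, ih h.2 (hr.infix ⟨[a], [], by simp⟩) hn.2⟩
    obtain ⟨b, hb, hba⟩ := List.mem_map.1 hmem
    by_cases hs : b.2 = a.2
    · have : b = a := Prod.ext hba hs
      exact hn.1 (this ▸ List.mem_map_of_mem hb)
    · have hfin : G.start b = G.finish a := by
        obtain ⟨e, s⟩ := a
        obtain ⟨e', s'⟩ := b
        obtain rfl : e' = e := hba
        obtain rfl : s' = !s := by revert hs; cases s <;> cases s' <;> simp
        exact start_not _ _
      cases p with
      | nil => simp at hb
      | cons d p =>
        have : b = d := List.inj_on_of_nodup_map hn.2 hb List.mem_cons_self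
          (hfin.trans h.2.1.symm)
        subst this
        rw [isReduced_cons_cons] at hr
        exact hs (hr.1 hba.symm).symm

/-- Every path contains an arc with the same end points. -/
theorem IsPath.exists_arc (h : G.IsPath u p v) :
    ∃ q, G.IsPath u q v ∧ (q.map G.start ++ [v]).Nodup ∧ q.Sublist p := by
  classical
  induction p generalizing u with
  | nil => exact ⟨[], h, by simp, List.Sublist.refl _⟩
  | cons a p ih =>
    obtain ⟨q, h1, h2, h3⟩ := ih h.2
    by_cases hu : u ∈ q.map G.start ++ [v]
    · rcases List.mem_append.1 hu with hu | hu
      · obtain ⟨b, hb, rfl⟩ := List.mem_map.1 hu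
        obtain ⟨q1, q2, rfl⟩ := List.append_of_mem hb
        obtain ⟨x, _, hx⟩ := isPath_append.1 h1
        refine ⟨b :: q2, ⟨rfl, hx.2⟩, ?_,
          ((List.sublist_append_right _ _).trans h3).trans (List.sublist_cons_self _ _)⟩
        rw [List.map_append, List.append_assoc] at h2
        exact (List.nodup_append.1 h2).2.1
      · obtain rfl : u = v := by simpa using hu
        exact ⟨[], rfl, by simp, List.nil_sublist _⟩
    · exact ⟨a :: q, ⟨h.1, h1⟩, by
        rw [List.map_cons, List.cons_append, List.nodup_cons, h.1]; exact ⟨hu, h2⟩,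
        h3.cons_cons a⟩

theorem IsSimpleClosedPath.of_arc {a : G.E × Bool} (h : G.IsPath (G.finish a) q (G.start a))
    (hn : (q.map G.start ++ [G.start a]).Nodup) (ha : a.1 ∉ q.map Prod.fst) :
    G.IsSimpleClosedPath (G.start a) (a :: q) := by
  refine ⟨by simp, ⟨rfl, h⟩, ?_, ?_⟩
  · rw [List.map_cons]
    exact (List.perm_append_singleton _ _).nodup_iff.1 hn
  · rw [List.map_cons, List.nodup_cons]
    exact ⟨ha, nodup_edges_of_arc h hn⟩

theorem IsSimpleClosedPath.rotate {a : G.E × Bool} (h : G.IsSimpleClosedPath v (p ++ a :: q)) :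
    G.IsSimpleClosedPath (G.start a) (a :: (q ++ p)) := by
  obtain ⟨_, h2, h3, h4⟩ := h
  obtain ⟨x, hx1, hx2⟩ := isPath_append.1 h2
  have hperm : (p ++ a :: q).Perm (a :: (q ++ p)) := by
    rw [← List.cons_append]; exact List.perm_append_comm
  exact ⟨by simp, ⟨rfl, hx2.2.append (hx2.1 ▸ hx1)⟩, ((hperm.map _).nodup_iff).1 h3,
    ((hperm.map _).nodup_iff).1 h4⟩

/-- A circle minus one of its edges is an arc. -/
theorem IsSimpleClosedPath.arc {a : G.E × Bool} (h : G.IsSimpleClosedPath v (a :: q)) :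
    G.IsPath (G.finish a) q (G.start a) ∧ (q.map G.start ++ [G.start a]).Nodup ∧
      a.1 ∉ q.map Prod.fst := by
  obtain ⟨_, h2, h3, h4⟩ := h
  refine ⟨by rw [h2.1]; exact h2.2, (List.perm_append_singleton _ _).nodup_iff.2 h3, ?_⟩
  rw [List.map_cons, List.nodup_cons] at h4
  exact h4.1

theorem IsSimpleClosedPath.isCyclicallyReduced (h : G.IsSimpleClosedPath v p) :
    IsCyclicallyReduced p := isCyclicallyReduced_of_nodup h.2.2.2

theorem IsSimpleClosedPath.exists_edge_eq {e : G.E} (h : G.IsSimpleClosedPath v p)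
    (he : e ∈ p.map Prod.fst) :
    ∃ a q, a.1 = e ∧ G.IsSimpleClosedPath (G.start a) (a :: q) ∧ p.Perm (a :: q) ∧
      IsConj (FreeGroup.mk p) (FreeGroup.mk (a :: q)) := by
  obtain ⟨a, ha, rfl⟩ := List.mem_map.1 he
  obtain ⟨p1, p2, rfl⟩ := List.append_of_mem ha
  refine ⟨a, p2 ++ p1, rfl, h.rotate, ?_, ?_⟩
  · rw [← List.cons_append]; exact List.perm_append_comm
  · rw [← List.cons_append, ← mul_mk, ← mul_mk, isConj_iff]
    exact ⟨(FreeGroup.mk p1)⁻¹, by group⟩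

/-- Here `p` is the embedded part already walked and `r` the rest. The walk stops at the first
vertex met twice; it must stop, since the whole path is closed and nonempty. -/
theorem IsPath.exists_first_return {r : List (G.E × Bool)} (h : G.IsPath v p u)
    (hn : (p.map G.start).Nodup) (hu : u ∉ p.map G.start) (hr : G.IsPath u r v)
    (hne : p ++ r ≠ []) :
    ∃ x s c r', s ++ c ++ r' = p ++ r ∧ c ≠ [] ∧ G.IsPath v s x ∧ G.IsPath x c x ∧
      G.IsPath x r' v ∧ ((s ++ c).map G.start).Nodup := by
  induction r generalizing p u with
  | nil =>
    obtain rfl : u = v := hr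
    cases p with
    | nil => simp at hne
    | cons a p => simp [h.1] at hu
  | cons a r ih =>
    have hp' : G.IsPath v (p ++ [a]) (G.finish a) := h.append ⟨hr.1, rfl⟩
    have hn' : ((p ++ [a]).map G.start).Nodup := by
      rw [List.map_append, List.map_singleton]
      refine (List.perm_append_singleton _ _).nodup_iff.2 (List.nodup_cons.2 ⟨?_, hn⟩)
      rwa [hr.1]
    by_cases hf : G.finish a ∈ (p ++ [a]).map G.start
    · obtain ⟨b, hb, hba⟩ := List.mem_map.1 hf
      obtain ⟨s, c, hsc⟩ := List.append_of_mem hb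
      rw [hsc] at hp' hn'
      obtain ⟨x, hx1, hx2⟩ := isPath_append.1 hp'
      have hxa : x = G.finish a := hx2.1.symm.trans hba
      subst hxa
      refine ⟨_, s, b :: c, r, ?_, by simp, hx1, hx2, hr.2, hn'⟩
      rw [← hsc]; simp
    · obtain ⟨x, s, c, r', h1, h2⟩ := ih hp' hn' hf hr.2 (by simp)
      exact ⟨x, s, c, r', by rw [h1]; simp, h2⟩

/-- Every nonempty closed path without backtracking contains a lollipop, consisting of an arc `s`
from its base point and a circle `c`, such that the loop going around the lollipop is not longer
than the given path. -/
theorem IsPath.exists_lollipop {f : G.E → ℝ} (hf : ∀ e, 0 ≤ f e) (h : G.IsPath v p v)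
    (hr : IsReduced p) (hp : p ≠ []) :
    ∃ x s c, G.IsPath v s x ∧ G.IsSimpleClosedPath x c ∧ ((s ++ c).map G.start).Nodup ∧
      ((s ++ c).map Prod.fst).Nodup ∧ (∀ a ∈ s ++ c, a.1 ∈ p.map Prod.fst) ∧
      2 * weight f s + weight f c ≤ weight f p := by
  classical
  induction hN : p.length using Nat.strong_induction_on generalizing p with
  | _ N ih =>
  obtain ⟨x, s, c, r, rfl, hc, hs, hcx, hrx, hn⟩ :=
    IsPath.exists_first_return (p := []) (u := v) rfl (by simp) (by simp) h (by simpa using hp)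
  have hed := nodup_edges_of_isReduced (hs.append hcx) (hr.infix ⟨[], r, by simp⟩) hn
  have hcs : G.IsSimpleClosedPath x c := by
    refine ⟨hc, hcx, ?_, ?_⟩
    · rw [List.map_append] at hn; exact (List.nodup_append.1 hn).2.1
    · rw [List.map_append] at hed; exact (List.nodup_append.1 hed).2.1
  -- Cut out the first circle `c`. If what remains is null-homotopic, then `r` is the inverse of `s`
  -- and the path is itself a lollipop loop; otherwise its reduction is a shorter closed path at the
  -- same base point.
  by_cases h1 : FreeGroup.reduce (s ++ r) = []
  · have hrs : r = FreeGroup.invRev s := by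
      refine IsReduced.eq_of_mk_eq (hr.infix ⟨s ++ c, [], by simp⟩)
        (FreeGroup.isReduced_invRev (hr.infix ⟨[], c ++ r, by simp⟩)) ?_
      have h2 : FreeGroup.mk (s ++ r) = 1 := by rw [← reduce.self, h1, one_eq_mk]
      rw [← mul_mk] at h2
      rw [← inv_mk]
      exact (inv_eq_of_mul_eq_one_right h2).symm
    refine ⟨x, s, c, hs, hcs, hn, hed, fun a ha => ?_, ?_⟩
    · exact List.mem_map_of_mem (List.mem_append_left _ ha)
    · subst hrs; simp; linarith
  · have hsub : (FreeGroup.reduce (s ++ r)).Sublist (s ++ r) := reduce.red.sublist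
    have hsub' : (s ++ r).Sublist (s ++ c ++ r) := by
      rw [List.append_assoc]
      exact (List.Sublist.refl s).append (List.sublist_append_right _ _)
    have hlen : (FreeGroup.reduce (s ++ r)).length < N := by
      have := hsub.length_le
      have hc' := List.length_pos_iff.2 hc
      simp only [List.length_append] at this hN
      omega
    obtain ⟨x', s', c', g1, g2, g3, g4, g5, g6⟩ := ih _ hlen (hs.append hrx).reduce
      (isReduced_iff_reduce_eq.2 reduce.idem) h1 rfl
    refine ⟨x', s', c', g1, g2, g3, g4, fun a ha => ?_, ?_⟩
    · exact ((hsub.trans hsub').map Prod.fst).subset (g5 a ha)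
    · exact g6.trans (weight_le_of_sublist hf (hsub.trans hsub'))

/-! ### Forests and spanning trees -/

/-- A set of edges is a forest if it contains no circle. -/
def IsForest (G : FinGraph) (T : Set G.E) : Prop :=
  ∀ v c, G.IsSimpleClosedPath v c → ¬ ∀ a ∈ c, a.1 ∈ T

/-- A spanning tree. -/
def IsSpanningTree (G : FinGraph) (T : Set G.E) : Prop :=
  G.IsForest T ∧ ∀ u v, ∃ p, G.IsPath u p v ∧ ∀ a ∈ p, a.1 ∈ T

/-- The circle of a lollipop in the path would lie in `T`. Lengths play no role, so the weight is
zero. -/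
theorem IsForest.eq_nil {T : Set G.E} (hT : G.IsForest T) (h : G.IsPath v p v)
    (hr : IsReduced p) (hpT : ∀ a ∈ p, a.1 ∈ T) : p = [] := by
  by_contra hp
  obtain ⟨x, s, c, -, hc, -, -, hsub, -⟩ := h.exists_lollipop (f := 0) (by simp) hr hp
  refine hT x c hc fun a ha => ?_
  obtain ⟨b, hb, hab⟩ := List.mem_map.1 (hsub a (List.mem_append_right _ ha))
  exact hab ▸ hpT b hb

/-- The initial vertex of an arc lies on no edge of the arc but the first. A circle using the first
edge would have to return to that vertex along later edges; a circle not using it lies in a shorter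
arc. -/
theorem IsSimpleClosedPath.not_subset_arc {c : List (G.E × Bool)} {x : G.V}
    (hc : G.IsSimpleClosedPath x c) (h : G.IsPath u p v) (hn : (p.map G.start ++ [v]).Nodup) :
    ¬ ∀ a ∈ c, a.1 ∈ p.map Prod.fst := by
  induction p generalizing u with
  | nil =>
    intro hsub
    obtain ⟨a, ha⟩ := List.exists_mem_of_ne_nil _ hc.1
    simpa using hsub a ha
  | cons d p ih =>
    intro hsub
    rw [List.map_cons, List.cons_append, List.nodup_cons] at hn
    by_cases hd : d.1 ∈ c.map Prod.fst
    · obtain ⟨a, q, had, hc', hperm, -⟩ := hc.exists_edge_eq hd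
      obtain ⟨hq, -, haq⟩ := hc'.arc
      have hqp : ∀ b ∈ q, b.1 ∈ p.map Prod.fst := by
        intro b hb
        have h1 := hsub b (hperm.symm.subset (List.mem_cons_of_mem _ hb))
        rw [List.map_cons, List.mem_cons] at h1
        refine h1.resolve_left fun h2 => haq ?_
        rw [had, ← h2]
        exact List.mem_map_of_mem hb
      have hstart : ∀ b ∈ q, G.start b ≠ G.start d ∧ G.finish b ≠ G.start d := by
        intro b hb
        obtain ⟨b', hb', hbb⟩ := List.mem_map.1 (hqp b hb)
        refine ⟨fun h1 => hn.1 (h1 ▸ h.2.endpoint_mem hb' hbb), fun h1 => hn.1 ?_⟩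
        rw [← h1, ← start_not]
        exact h.2.endpoint_mem hb' hbb
      have hq0 : G.finish d ≠ G.start d := fun h1 => hn.1 (h1 ▸ h.2.start_mem)
      have hends : G.start a = G.start d ∨ G.finish a = G.start d := by
        obtain ⟨e, s⟩ := a
        obtain ⟨e', s'⟩ := d
        obtain rfl : e = e' := had
        cases s <;> cases s' <;> simp [start, finish]
      have hne : G.start a ≠ G.finish a := by
        obtain ⟨e, s⟩ := a
        obtain ⟨e', s'⟩ := d
        obtain rfl : e = e' := had
        revert hq0
        cases s <;> cases s' <;> simp [start, finish, eq_comm]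
      have hm := hq.cons_map_finish
      rcases hends with h1 | h1
      · have : G.start a ∈ G.finish a :: q.map G.finish := by rw [hm]; simp
        rcases List.mem_cons.1 this with h2 | h2
        · exact hne h2
        · obtain ⟨b, hb, hb'⟩ := List.mem_map.1 h2
          exact (hstart b hb).2 (hb'.trans h1)
      · rcases List.mem_append.1 hq.start_mem with h2 | h2
        · obtain ⟨b, hb, hb'⟩ := List.mem_map.1 h2
          exact (hstart b hb).1 (hb'.trans h1)
        · exact hne (List.mem_singleton.1 h2).symm
    · refine ih h.2 hn.2 fun a ha => ?_
      have h1 := hsub a ha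
      rw [List.map_cons, List.mem_cons] at h1
      refine h1.resolve_left fun h2 => hd ?_
      rw [← h2]
      exact List.mem_map_of_mem ha

/-- Every forest in a connected finite graph extends to a spanning tree. -/
theorem IsForest.exists_spanningTree (hconn : ∀ u v : G.V, ∃ p, G.IsPath u p v) {T₀ : Set G.E}
    (h₀ : G.IsForest T₀) : ∃ T, T₀ ⊆ T ∧ G.IsSpanningTree T := by
  classical
  have := G.finE
  obtain ⟨T, hle, hT⟩ := Finite.exists_le_maximal (p := G.IsForest) h₀
  refine ⟨T, hle, hT.1, ?_⟩
  -- By maximality an edge outside `T` closes a circle with edges of `T`, and the rest of this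
  -- circle joins its end points inside `T`.
  have hedge : ∀ a : G.E × Bool, ∃ p, G.IsPath (G.start a) p (G.finish a) ∧ ∀ b ∈ p, b.1 ∈ T := by
    intro a
    by_cases haT : a.1 ∈ T
    · exact ⟨[a], ⟨rfl, rfl⟩, by simpa using haT⟩
    have hnot : ¬ G.IsForest (insert a.1 T) := fun h =>
      haT (hT.2 h (Set.subset_insert _ _) (Set.mem_insert _ _))
    obtain ⟨v, c, hc, hcT⟩ : ∃ v c, G.IsSimpleClosedPath v c ∧ ∀ b ∈ c, b.1 ∈ insert a.1 T := by
      by_contra! hno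
      refine hnot fun v c hc hcT => ?_
      obtain ⟨b, hb, hbT⟩ := hno v c hc
      exact hbT (hcT b hb)
    have hac : a.1 ∈ c.map Prod.fst := by
      by_contra hac
      refine hT.1 v c hc fun b hb => (hcT b hb).resolve_left fun h => hac ?_
      exact h ▸ List.mem_map_of_mem hb
    obtain ⟨d, q, hd, hc', hperm, -⟩ := hc.exists_edge_eq hac
    obtain ⟨hq, -, hdq⟩ := hc'.arc
    have hqT : ∀ b ∈ q, b.1 ∈ T := fun b hb =>
      (hcT b (hperm.symm.subset (List.mem_cons_of_mem _ hb))).resolve_left fun h => hdq (by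
        rw [hd, ← h]; exact List.mem_map_of_mem hb)
    have hqT' : ∀ b ∈ invRev q, b.1 ∈ T := fun b hb => hqT (b.1, !b.2) (mem_invRev.1 hb)
    obtain ⟨e, s⟩ := a
    obtain ⟨e', s'⟩ := d
    obtain rfl : e' = e := hd
    by_cases hs : s = s'
    · subst hs; exact ⟨_, hq.invRev, hqT'⟩
    · obtain rfl : s' = !s := by revert hs; cases s <;> cases s' <;> simp
      rw [start_not, finish_not] at hq
      exact ⟨_, hq, hqT⟩
  intro u v
  obtain ⟨p, hp⟩ := hconn u v
  induction p generalizing u with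
  | nil => exact ⟨[], hp, by simp⟩
  | cons a p ih =>
    obtain ⟨p1, h1, h2⟩ := hedge a
    obtain ⟨p2, h3, h4⟩ := ih _ hp.2
    exact ⟨p1 ++ p2, hp.1 ▸ h1.append h3, fun b hb => (List.mem_append.1 hb).elim (h2 b) (h4 b)⟩

/-- Exchanging an edge `x` of a spanning tree for another edge of the circle `a q` that consists of
`a` and edges of the tree. -/
theorem IsSpanningTree.exchange {T : Set G.E} (hT : G.IsSpanningTree T) {a : G.E × Bool} {x : G.E}
    (hc : G.IsSimpleClosedPath v (a :: q)) (haT : a.1 ∉ T) (hqT : ∀ b ∈ q, b.1 ∈ T)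
    (hx : x ∈ q.map Prod.fst) : G.IsSpanningTree (insert a.1 (T \ {x})) := by
  obtain ⟨hqp, -, -⟩ := hc.arc
  have hqred : IsReduced q := hc.isCyclicallyReduced.isReduced.infix ⟨[a], [], by simp⟩
  have hforest : G.IsForest (insert a.1 (T \ {x})) := by
    intro w c hcw hcT
    have hac : a.1 ∈ c.map Prod.fst := by
      by_contra hac
      refine hT.1 w c hcw fun b hb => ((hcT b hb).resolve_left fun h => hac ?_).1
      exact h ▸ List.mem_map_of_mem hb
    obtain ⟨d, r, hd, hc', hperm, -⟩ := hcw.exists_edge_eq hac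
    obtain ⟨hr, -, hdr⟩ := hc'.arc
    have hrT : ∀ b ∈ r, b.1 ∈ T \ {x} := fun b hb =>
      (hcT b (hperm.symm.subset (List.mem_cons_of_mem _ hb))).resolve_left fun h => hdr (by
        rw [hd, ← h]; exact List.mem_map_of_mem hb)
    have hrred : IsReduced r := hc'.isCyclicallyReduced.isReduced.infix ⟨[d], [], by simp⟩
    -- Reduced paths in a forest are determined by their end points, so a path in `T` between the
    -- ends of `a` must be `q`, which crosses `x`.
    have key : ∀ r', G.IsPath (G.finish a) r' (G.start a) → IsReduced r' →
        (∀ b ∈ r', b.1 ∈ T \ {x}) → False := by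
      classical
      intro r' h1 h2 h3
      have h4 : FreeGroup.reduce (q ++ invRev r') = [] := by
        refine hT.1.eq_nil (hqp.append h1.invRev).reduce (isReduced_iff_reduce_eq.2 reduce.idem) ?_
        intro b hb
        rcases List.mem_append.1 (reduce.red.sublist.subset hb) with h | h
        · exact hqT b h
        · exact (h3 _ (mem_invRev.1 h)).1
      have h5 : q = r' := by
        refine IsReduced.eq_of_mk_eq hqred h2 ?_
        have h6 : FreeGroup.mk (q ++ invRev r') = 1 := by rw [← reduce.self, h4, one_eq_mk]
        rw [← mul_mk, ← inv_mk] at h6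
        exact mul_inv_eq_one.1 h6
      obtain ⟨b, hb, rfl⟩ := List.mem_map.1 hx
      exact (h3 b (h5 ▸ hb)).2 rfl
    obtain ⟨e, s⟩ := a
    obtain ⟨e', s'⟩ := d
    obtain rfl : e' = e := hd
    by_cases hs : s = s'
    · subst hs; exact key r hr hrred hrT
    · obtain rfl : s' = !s := by revert hs; cases s <;> cases s' <;> simp
      rw [start_not, finish_not] at hr
      exact key _ hr.invRev (isReduced_invRev hrred) fun b hb => hrT (b.1, !b.2) (mem_invRev.1 hb)
  refine ⟨hforest, ?_⟩
  obtain ⟨y, hy, rfl⟩ := List.mem_map.1 hx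
  obtain ⟨q1, q2, rfl⟩ := List.append_of_mem hy
  have hned : ((q1 ++ y :: q2).map Prod.fst).Nodup := by
    have := hc.2.2.2
    rw [List.map_cons, List.nodup_cons] at this
    exact this.2
  obtain ⟨z, hz1, hz2⟩ := isPath_append.1 hqp
  have hy1 : ∀ b ∈ q1 ++ q2, b.1 ∈ T \ {y.1} := by
    have hperm : (q1 ++ y :: q2).Perm (y :: (q1 ++ q2)) := List.perm_middle
    rw [(hperm.map _).nodup_iff, List.map_cons, List.nodup_cons] at hned
    intro b hb
    refine ⟨hqT b (hperm.symm.subset (List.mem_cons_of_mem _ hb)), fun h => hned.1 ?_⟩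
    rw [← (show b.1 = y.1 from h)]
    exact List.mem_map_of_mem hb
  -- the detour around `y`
  have hdet : G.IsPath (G.finish y) (q2 ++ a :: q1) (G.start y) :=
    hz2.2.append ⟨rfl, hz2.1 ▸ hz1⟩
  have hdetT : ∀ b ∈ q2 ++ a :: q1, b.1 ∈ insert a.1 (T \ {y.1}) := by
    intro b hb
    rcases List.mem_append.1 hb with h | h
    · exact Or.inr (hy1 b (List.mem_append_right _ h))
    · rcases List.mem_cons.1 h with rfl | h
      · exact Or.inl rfl
      · exact Or.inr (hy1 b (List.mem_append_left _ h))
  have hedge : ∀ b : G.E × Bool, b.1 ∈ T → ∃ p, G.IsPath (G.start b) p (G.finish b) ∧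
      ∀ d ∈ p, d.1 ∈ insert a.1 (T \ {y.1}) := by
    intro b hb
    by_cases hby : b.1 = y.1
    · obtain ⟨e, s⟩ := b
      obtain ⟨e', s'⟩ := y
      obtain rfl : e = e' := hby
      by_cases hs : s = s'
      · subst hs; exact ⟨_, hdet.invRev, fun d hd => hdetT (d.1, !d.2) (mem_invRev.1 hd)⟩
      · obtain rfl : s' = !s := by revert hs; cases s <;> cases s' <;> simp
        rw [start_not, finish_not] at hdet
        exact ⟨_, hdet, hdetT⟩
    · exact ⟨[b], ⟨rfl, rfl⟩, by simpa using Or.inr ⟨hb, hby⟩⟩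
  intro u v
  obtain ⟨p, hp, hpT⟩ := hT.2 u v
  induction p generalizing u with
  | nil => exact ⟨[], hp, by simp⟩
  | cons b p ih =>
    obtain ⟨p1, h1, h2⟩ := hedge b (hpT b List.mem_cons_self)
    obtain ⟨p2, h3, h4⟩ := ih _ hp.2 fun d hd => hpT d (List.mem_cons_of_mem _ hd)
    exact ⟨p1 ++ p2, hp.1 ▸ h1.append h3, fun b hb => (List.mem_append.1 hb).elim (h2 b) (h4 b)⟩

end FinGraph

/-! ## Collapses onto roses -/

namespace FreeGroup

/-- The weight that counts the occurrences of one letter. -/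
noncomputable def indicator {α : Type*} (e : α) : α → ℝ :=
  open Classical in fun a => if a = e then 1 else 0

theorem indicator_nonneg {α : Type*} (e a : α) : 0 ≤ indicator e a := by
  unfold indicator; split_ifs <;> norm_num

theorem indicator_self {α : Type*} (e : α) : indicator e e = 1 := by simp [indicator]

theorem indicator_of_ne {α : Type*} {a e : α} (h : a ≠ e) : indicator e a = 0 := by
  simp [indicator, h]

open Classical in
theorem weight_indicator {α : Type*} (e : α) (p : List (α × Bool)) :
    weight (indicator e) p = ((p.map Prod.fst).count e : ℕ) := by
  induction p with
  | nil => simp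
  | cons a p ih =>
    rw [weight_cons, ih]
    by_cases h : a.1 = e
    · simp [h, indicator_self, add_comm]
    · simp [h, indicator_of_ne]

theorem weight_indicator_eq_zero {α : Type*} {e : α} {p : List (α × Bool)}
    (h : e ∉ p.map Prod.fst) : weight (indicator e) p = 0 := by
  classical
  rw [weight_indicator, List.count_eq_zero_of_not_mem h, Nat.cast_zero]

theorem weight_indicator_eq_one {α : Type*} {e : α} {p : List (α × Bool)}
    (hn : (p.map Prod.fst).Nodup) (h : e ∈ p.map Prod.fst) : weight (indicator e) p = 1 := by
  classical
  rw [weight_indicator, List.count_eq_one_of_mem hn h, Nat.cast_one]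

theorem isReduced_reduce {α : Type*} [DecidableEq α] (p : List (α × Bool)) :
    IsReduced (reduce p) := isReduced_iff_reduce_eq.2 reduce.idem

end FreeGroup

namespace FinGraph

open FreeGroup

variable {G : FinGraph} {u v : G.V}

theorem mk_mem_fundGroup {p : List (G.E × Bool)} (h : G.IsPath v p v) :
    FreeGroup.mk p ∈ G.fundGroup v := ⟨p, h, rfl⟩

open Classical in
theorem isPath_toWord {g : FreeGroup G.E} (hg : g ∈ G.fundGroup v) : G.IsPath v g.toWord v := by
  obtain ⟨p, hp, rfl⟩ := hg
  rw [toWord_mk]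
  exact hp.reduce

theorem fundGroup_conj {s : List (G.E × Bool)} (hs : G.IsPath u s v) {g : FreeGroup G.E}
    (hg : g ∈ G.fundGroup v) : FreeGroup.mk s * g * (FreeGroup.mk s)⁻¹ ∈ G.fundGroup u := by
  obtain ⟨p, hp, rfl⟩ := hg
  rw [inv_mk, mul_mk, mul_mk]
  exact mk_mem_fundGroup ((hs.append hp).append hs.invRev)

end FinGraph

namespace Collapse

open FreeGroup

variable {G H : FinGraph} (C : Collapse G H)

theorem hom_of_none {e : G.E} (h : C.onE e = none) : C.hom (of e) = 1 := by
  simp [hom, h]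

theorem hom_of_some {e : G.E} {a : H.E × Bool} (h : C.onE e = some a) :
    C.hom (of e) = FreeGroup.mk [a] := by
  simp [hom, h]

theorem hom_singleton_of_none {a : G.E × Bool} (h : C.onE a.1 = none) :
    C.hom (FreeGroup.mk [a]) = 1 := by
  simp [hom, lift_mk, h]

theorem hom_singleton_of_some {e : G.E} {s t : Bool} {e' : H.E} (h : C.onE e = some (e', t)) :
    C.hom (FreeGroup.mk [(e, s)]) = FreeGroup.mk [(e', t == s)] := by
  cases s
  · simp [hom, lift_mk, h, inv_mk, invRev]
  · simp [hom, lift_mk, h]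

theorem hom_mk_cons (a : G.E × Bool) (p : List (G.E × Bool)) :
    C.hom (FreeGroup.mk (a :: p)) = C.hom (FreeGroup.mk [a]) * C.hom (FreeGroup.mk p) := by
  rw [← _root_.map_mul, mul_mk]; rfl

theorem hom_mk_append (p q : List (G.E × Bool)) :
    C.hom (FreeGroup.mk (p ++ q)) = C.hom (FreeGroup.mk p) * C.hom (FreeGroup.mk q) := by
  rw [← _root_.map_mul, mul_mk]

theorem hom_mk_of_collapsed {p : List (G.E × Bool)} (h : ∀ a ∈ p, C.onE a.1 = none) :
    C.hom (FreeGroup.mk p) = 1 := by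
  induction p with
  | nil => rw [← one_eq_mk, _root_.map_one]
  | cons a p ih =>
    rw [hom_mk_cons, hom_singleton_of_none C (h a List.mem_cons_self),
      ih fun b hb => h b (List.mem_cons_of_mem _ hb), one_mul]

/-- The edge of `G` that becomes the edge `e'` of `H`. -/
theorem exists_onE_eq (e' : H.E) : ∃ e b, C.onE e = some (e', b) :=
  (C.edge_bij e').exists

theorem onE_inj {e₁ e₂ : G.E} {e' : H.E} {b₁ b₂ : Bool} (h₁ : C.onE e₁ = some (e', b₁))
    (h₂ : C.onE e₂ = some (e', b₂)) : e₁ = e₂ :=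
  (C.edge_bij e').unique ⟨_, h₁⟩ ⟨_, h₂⟩

end Collapse

namespace MarkedGraph

open FreeGroup

variable {n : ℕ} {G H R : MarkedGraph n}

theorem mark_mem (G : MarkedGraph n) (w : FreeGroup (Fin n)) :
    G.mark w ∈ G.fundGroup G.base := by
  rw [← G.mark_range]; exact ⟨w, rfl⟩

/-- Every closed edge path represents a conjugacy class. -/
theorem exists_represents {v : G.V} {c : List (G.E × Bool)} (hc : G.IsPath v c v) :
    ∃ w, G.Represents c w := by
  obtain ⟨s, hs⟩ := G.connected G.base v
  have h := FinGraph.fundGroup_conj hs (FinGraph.mk_mem_fundGroup hc)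
  rw [← G.mark_range] at h
  obtain ⟨w, hw⟩ := h
  exact ⟨w, isConj_iff.2 ⟨_, hw.symm⟩⟩

theorem geodesic_isPath (G : MarkedGraph n) (w : FreeGroup (Fin n)) :
    ∃ v, G.IsPath v (G.geodesic w) v := by
  classical
  have h := FinGraph.isPath_toWord (G.mark_mem w)
  rw [← reduceCyclically.conj_conjugator_reduceCyclically (G.mark w).toWord] at h
  obtain ⟨x, h1, h3⟩ := FinGraph.isPath_append.1 h
  obtain ⟨y, h0, h2⟩ := FinGraph.isPath_append.1 h1
  have h4 := h3.invRev
  rw [invRev_invRev] at h4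
  obtain rfl := h0.end_unique h4
  exact ⟨_, h2⟩

open Classical in
theorem geodesic_isCyclicallyReduced (G : MarkedGraph n) (w : FreeGroup (Fin n)) :
    IsCyclicallyReduced (G.geodesic w) := reduceCyclically.isCyclicallyReduced isReduced_toWord

theorem mark_ne_one (G : MarkedGraph n) {w : FreeGroup (Fin n)} (hw : w ≠ 1) : G.mark w ≠ 1 :=
  fun h => hw (G.mark_injective (by rw [h, _root_.map_one]))

theorem geodesic_ne_nil (G : MarkedGraph n) {w : FreeGroup (Fin n)} (hw : w ≠ 1) :
    G.geodesic w ≠ [] := reduceCyclically_toWord_ne_nil (G.mark_ne_one hw)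

theorem geodesic_one (G : MarkedGraph n) : G.geodesic 1 = [] := by
  simp [geodesic]

theorem crossings_eq_weight (G : MarkedGraph n) (e : G.E) (w : FreeGroup (Fin n)) :
    (G.crossings e w : ℝ) = weight (indicator e) (G.geodesic w) := by
  rw [weight_indicator, crossings]

/-- Crossing numbers are translation lengths for a degenerate weight, so conjugacy invariance and
the stretching bound apply to them. This is why those results ask only for nonnegative weights. -/
theorem crossings_eq_transLen (G : MarkedGraph n) (e : G.E) (w : FreeGroup (Fin n)) :
    (G.crossings e w : ℝ) = transLen (indicator e) (G.mark w) := G.crossings_eq_weight e w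

theorem _root_.MarkedMetricGraph.loopLen_eq_weight (X : MarkedMetricGraph n)
    (w : FreeGroup (Fin n)) : X.loopLen w = weight X.len (X.graph.geodesic w) := rfl

theorem _root_.MarkedMetricGraph.loopLen_eq_transLen (X : MarkedMetricGraph n)
    (w : FreeGroup (Fin n)) : X.loopLen w = transLen X.len (X.graph.mark w) := rfl

theorem _root_.MarkedMetricGraph.loopLen_pos (X : MarkedMetricGraph n)
    {w : FreeGroup (Fin n)} (hw : w ≠ 1) : 0 < X.loopLen w :=
  weight_pos X.len_pos (X.graph.geodesic_ne_nil hw)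

theorem Represents.transLen_eq {c : List (G.E × Bool)} {w : FreeGroup (Fin n)} {f : G.E → ℝ}
    (h : G.Represents c w) (hf : ∀ e, 0 ≤ f e) (hc : IsCyclicallyReduced c) :
    transLen f (G.mark w) = weight f c := by
  rw [← transLen_eq_of_isConj hf h, transLen_mk f hc]

theorem Represents.ne_one {c : List (G.E × Bool)} {w : FreeGroup (Fin n)}
    (h : G.Represents c w) (hc : IsReduced c) (hne : c ≠ []) : w ≠ 1 := by
  rintro rfl
  rw [Represents, _root_.map_one, isConj_one_left, one_eq_mk] at h
  exact hne (hc.eq_of_mk_eq IsReduced.nil h)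

theorem IsSimpleLoop.ne_one {w : FreeGroup (Fin n)} (h : G.IsSimpleLoop w) : w ≠ 1 := by
  obtain ⟨v, p, hp, hw⟩ := h
  exact hw.ne_one hp.isCyclicallyReduced.isReduced hp.1

theorem IsRose.isPath (hR : R.IsRose) (u v : R.V) (p : List (R.E × Bool)) : R.IsPath u p v := by
  induction p generalizing u with
  | nil => exact (hR u).trans (hR v).symm
  | cons a p ih => exact ⟨(hR _).trans (hR u).symm, ih _⟩

theorem IsRose.mark_surjective (hR : R.IsRose) : Function.Surjective R.mark := by
  intro g
  induction g using Quot.inductionOn with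
  | _ p =>
    have : FreeGroup.mk p ∈ R.fundGroup R.base := FinGraph.mk_mem_fundGroup (hR.isPath _ _ p)
    rw [← R.mark_range] at this
    exact this

theorem IsRose.card_edges (hR : R.IsRose) : Nat.card R.E = n := by
  have e := MulEquiv.ofBijective R.mark ⟨R.mark_injective, hR.mark_surjective⟩
  rw [← Nat.card_congr (Equiv.ofFreeGroupEquiv e), Nat.card_eq_fintype_card, Fintype.card_fin]

/-- In a rose every word is an edge loop, so `mark` is onto and conjugators pull back to the marking
group. -/
theorem IsRose.isConj_of_isConj_mark (hR : R.IsRose) {w w' : FreeGroup (Fin n)}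
    (h : IsConj (R.mark w) (R.mark w')) : IsConj w w' := by
  obtain ⟨c, hc⟩ := isConj_iff.1 h
  obtain ⟨d, rfl⟩ := hR.mark_surjective c
  refine isConj_iff.2 ⟨d, R.mark_injective ?_⟩
  rw [← hc]; simp

section collapse

variable {C : Collapse G.toFinGraph R.toFinGraph}

theorem Respects.isConj (hC : Respects C) (w : FreeGroup (Fin n)) :
    IsConj (C.hom (G.mark w)) (R.mark w) := by
  obtain ⟨p, -, hp⟩ := hC
  exact isConj_iff.2 ⟨_, (hp w).symm⟩

/-- A collapse of marked graphs of the same rank is injective on fundamental groups. -/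
theorem Respects.eq_one_of_hom_eq_one (hC : Respects C) {v : G.V} {g : FreeGroup G.E}
    (hg : g ∈ G.fundGroup v) (h : C.hom g = 1) : g = 1 := by
  obtain ⟨s, hs⟩ := G.connected G.base v
  have h1 := FinGraph.fundGroup_conj hs hg
  rw [← G.mark_range] at h1
  obtain ⟨w, hw⟩ := h1
  have h2 := hC.isConj w
  rw [hw, _root_.map_mul, _root_.map_mul, h, mul_one, ← _root_.map_mul, mul_inv_cancel,
    _root_.map_one, isConj_one_right] at h2
  have hw1 : w = 1 := R.mark_injective (by rw [h2, _root_.map_one])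
  rw [hw1, _root_.map_one] at hw
  have : g = (FreeGroup.mk s)⁻¹ * (FreeGroup.mk s * g * (FreeGroup.mk s)⁻¹) * FreeGroup.mk s := by
    group
  rw [this, ← hw]; group

theorem Respects.eq_of_hom_eq (hC : Respects C) {v : G.V} {g h : FreeGroup G.E}
    (hg : g ∈ G.fundGroup v) (hh : h ∈ G.fundGroup v) (hgh : C.hom g = C.hom h) : g = h := by
  rw [← mul_inv_eq_one]
  refine hC.eq_one_of_hom_eq_one ((G.fundGroup v).mul_mem hg ((G.fundGroup v).inv_mem hh)) ?_
  rw [_root_.map_mul, _root_.map_inv, hgh, mul_inv_cancel]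

theorem IsRose.exists_collapsed_path (hR : R.IsRose) (C : Collapse G.toFinGraph R.toFinGraph)
    (u v : G.V) : ∃ p, G.IsPath u p v ∧ ∀ a ∈ p, C.onE a.1 = none :=
  C.fiber u v ((hR _).trans (hR _).symm)

/-- A collapsed circle would be a nontrivial element of a fundamental group killed by the collapse.
-/
theorem Respects.isForest (hC : Respects C) : G.IsForest {e | C.onE e = none} := by
  intro v c hc hcT
  have h1 := hC.eq_one_of_hom_eq_one (FinGraph.mk_mem_fundGroup hc.2.1)
    (C.hom_mk_of_collapsed hcT)
  rw [one_eq_mk] at h1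
  exact hc.1 (hc.isCyclicallyReduced.isReduced.eq_of_mk_eq IsReduced.nil h1)

theorem Respects.represents_iff (hR : R.IsRose) (hC : Respects C) {v : G.V}
    {c : List (G.E × Bool)} (hc : G.IsPath v c v) (w : FreeGroup (Fin n)) :
    G.Represents c w ↔ IsConj (C.hom (FreeGroup.mk c)) (R.mark w) := by
  refine ⟨fun h => (C.hom.map_isConj h).trans (hC.isConj w), fun h => ?_⟩
  obtain ⟨w₀, hw₀⟩ := exists_represents hc
  have h1 : IsConj (R.mark w₀) (R.mark w) :=
    ((hC.isConj w₀).symm.trans (C.hom.map_isConj hw₀).symm).trans h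
  exact hw₀.trans (G.mark.map_isConj (hR.isConj_of_isConj_mark h1))

/-- In the preimage of an oriented petal there is a circle crossing exactly one edge that is not
collapsed. -/
theorem IsRose.exists_circle (hR : R.IsRose) (C : Collapse G.toFinGraph R.toFinGraph)
    (e' : R.E) (s : Bool) :
    ∃ a q b, G.IsSimpleClosedPath (G.start a) (a :: q) ∧ (∀ d ∈ q, C.onE d.1 = none) ∧
      C.onE a.1 = some (e', b) ∧ C.hom (FreeGroup.mk (a :: q)) = FreeGroup.mk [(e', s)] := by
  obtain ⟨e, b, he⟩ := C.exists_onE_eq e'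
  -- The direction is chosen so that the image is `(e', s)`, because `b == (b == s)` is `s`.
  set a : G.E × Bool := (e, b == s) with ha
  obtain ⟨p, hp, hpT⟩ := hR.exists_collapsed_path C (G.finish a) (G.start a)
  obtain ⟨q, hq, hqn, hqp⟩ := hp.exists_arc
  have hqT : ∀ d ∈ q, C.onE d.1 = none := fun d hd => hpT d (hqp.subset hd)
  refine ⟨a, q, b, FinGraph.IsSimpleClosedPath.of_arc hq hqn fun hmem => ?_, hqT, he, ?_⟩
  · obtain ⟨d, hd, hda⟩ := List.mem_map.1 hmem
    have := hqT d hd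
    rw [hda, ha, he] at this
    simp at this
  · rw [C.hom_mk_cons, C.hom_mk_of_collapsed hqT, mul_one, C.hom_singleton_of_some he]
    cases b <;> cases s <;> rfl

/-- Lifts of the petals of a rose to closed paths at a given vertex. -/
theorem IsRose.exists_lifts (hR : R.IsRose) (C : Collapse G.toFinGraph R.toFinGraph) (v : G.V) :
    ∃ l : R.E → List (G.E × Bool), ∀ e', G.IsPath v (l e') v ∧
      C.hom (FreeGroup.mk (l e')) = of e' ∧
      ∀ e b e₁, C.onE e = some (e₁, b) → weight (indicator e) (l e') = indicator e₁ e' := by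
  have key : ∀ e', ∃ l, G.IsPath v l v ∧ C.hom (FreeGroup.mk l) = of e' ∧
      ∀ e b e₁, C.onE e = some (e₁, b) → weight (indicator e) l = indicator e₁ e' := by
    intro e'
    obtain ⟨e, b, he⟩ := C.exists_onE_eq e'
    obtain ⟨p, hp, hpT⟩ := hR.exists_collapsed_path C v (G.start (e, b))
    obtain ⟨q, hq, hqT⟩ := hR.exists_collapsed_path C (G.finish (e, b)) v
    refine ⟨p ++ (e, b) :: q, hp.append ⟨rfl, hq⟩, ?_, ?_⟩
    · rw [C.hom_mk_append, C.hom_mk_cons, C.hom_mk_of_collapsed hpT, C.hom_mk_of_collapsed hqT,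
        mul_one, one_mul, C.hom_singleton_of_some he]
      cases b <;> rfl
    · intro d t e₁ hd
      have hnot : ∀ p : List (G.E × Bool), (∀ a ∈ p, C.onE a.1 = none) → d ∉ p.map Prod.fst := by
        intro p hp hmem
        obtain ⟨a, ha, rfl⟩ := List.mem_map.1 hmem
        rw [hp a ha] at hd
        simp at hd
      rw [weight_append, weight_cons, weight_indicator_eq_zero (hnot p hpT),
        weight_indicator_eq_zero (hnot q hqT), zero_add, add_zero]
      by_cases h : e' = e₁
      · subst h
        rw [C.onE_inj he hd, indicator_self, indicator_self]
      · rw [indicator_of_ne h, indicator_of_ne]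
        rintro rfl
        rw [he] at hd
        simp at hd
        exact h hd.1
  choose l hl using key
  exact ⟨l, hl⟩

/-- Lifting the petals to closed paths at a vertex inverts the collapse. -/
theorem Respects.isConj_lift (hC : Respects C) {v : G.V}
    {l : R.E → List (G.E × Bool)}
    (hl : ∀ e', G.IsPath v (l e') v ∧ C.hom (FreeGroup.mk (l e')) = of e')
    (w : FreeGroup (Fin n)) :
    IsConj (lift (fun e' => FreeGroup.mk (l e')) (R.mark w)) (G.mark w) := by
  set Φ := lift fun e' => FreeGroup.mk (l e')
  have hΦ : ∀ x, C.hom (Φ x) = x := by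
    intro x
    have : C.hom.comp Φ = MonoidHom.id _ := by
      ext e'
      simp [Φ, (hl e').2]
    exact DFunLike.congr_fun this x
  have hΦv : ∀ x, Φ x ∈ G.fundGroup v := by
    intro x
    have : Φ.range ≤ G.fundGroup v := by
      refine range_lift_le ?_
      rintro _ ⟨e', rfl⟩
      exact FinGraph.mk_mem_fundGroup (hl e').1
    exact this ⟨x, rfl⟩
  obtain ⟨s, hs⟩ := G.connected v G.base
  have h1 := FinGraph.fundGroup_conj hs (G.mark_mem w)
  -- Both sides lie in the fundamental group at `v`, where the collapse is injective, and they have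
  -- the same image because `Φ` is a section of the collapse.
  have h2 : FreeGroup.mk s * G.mark w * (FreeGroup.mk s)⁻¹ =
      Φ (C.hom (FreeGroup.mk s * G.mark w * (FreeGroup.mk s)⁻¹)) :=
    hC.eq_of_hom_eq h1 (hΦv _) (hΦ _).symm
  have h3 : IsConj (R.mark w) (C.hom (FreeGroup.mk s * G.mark w * (FreeGroup.mk s)⁻¹)) :=
    (hC.isConj w).symm.trans (C.hom.map_isConj (isConj_iff.2 ⟨_, rfl⟩))
  refine (Φ.map_isConj h3).trans ?_
  rw [← h2]
  exact (isConj_iff.2 ⟨_, rfl⟩ : IsConj (G.mark w) _).symm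

theorem _root_.FreeGroup.transLen_mono {α : Type*} {f g : α → ℝ} (h : ∀ a, f a ≤ g a)
    (x : FreeGroup α) : transLen f x ≤ transLen g x := weight_mono h _

/-- The geodesics in a graph and in a rose obtained from it cross corresponding edges equally
often. -/
theorem Respects.crossings_eq (hR : R.IsRose) (hC : Respects C) {e : G.E} {e' : R.E} {b : Bool}
    (he : C.onE e = some (e', b)) (w : FreeGroup (Fin n)) :
    R.crossings e' w = G.crossings e w := by
  have hcast : (R.crossings e' w : ℝ) = G.crossings e w := by
    rw [crossings_eq_transLen, crossings_eq_transLen]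
    -- Under the collapse only `e` maps onto `e'`, and it crosses it once; the chosen lift of a
    -- petal crosses `e` once if the petal is `e'` and never otherwise. The stretching bound for
    -- each of the two maps gives one inequality.
    apply le_antisymm
    · rw [← transLen_eq_of_isConj (indicator_nonneg e') (hC.isConj w)]
      refine (transLen_map_le (indicator_nonneg e') C.hom _).trans (transLen_mono (fun d => ?_) _)
      rcases hd : C.onE d with _ | ⟨d', t⟩
      · rw [C.hom_of_none hd, wordNorm_one]
        exact indicator_nonneg _ _
      · rw [C.hom_of_some hd]
        refine (wordNorm_mk_le (indicator_nonneg e') _).trans ?_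
        rw [weight_cons, weight_nil, add_zero]
        by_cases h : d' = e'
        · subst h
          rw [C.onE_inj hd he, indicator_self, indicator_self]
        · rw [indicator_of_ne (by exact h)]
          exact indicator_nonneg _ _
    · obtain ⟨l, hl⟩ := hR.exists_lifts C G.base
      rw [← transLen_eq_of_isConj (indicator_nonneg e)
        (hC.isConj_lift (fun d => ⟨(hl d).1, (hl d).2.1⟩) w)]
      refine (transLen_map_le (indicator_nonneg e) _ _).trans (transLen_mono (fun d => ?_) _)
      rw [lift_apply_of]
      refine (wordNorm_mk_le (indicator_nonneg e) _).trans ?_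
      rw [(hl d).2.2 e b e' he]
  exact_mod_cast hcast

end collapse

end MarkedGraph

/-! ## Composition of collapses, and the rose of a spanning tree -/

theorem FreeGroup.mk_singleton_false {α : Type*} (e : α) :
    FreeGroup.mk [(e, false)] = (FreeGroup.of e)⁻¹ := by
  simp [FreeGroup.of, FreeGroup.inv_mk, FreeGroup.invRev]

namespace Collapse

open FreeGroup

variable {G H K : FinGraph}

/-- With `true` read as `+1` and `false` as `-1`, `==` is the product of signs. Directions compose
this way throughout. -/
theorem map_oriented (C : Collapse G H) {e : G.E} {a : H.E} {t : Bool} (h : C.onE e = some (a, t))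
    (s : Bool) : H.start (a, t == s) = C.onV (G.start (e, s)) ∧
      H.finish (a, t == s) = C.onV (G.finish (e, s)) := by
  have := C.map_edge e _ h
  cases s
  · cases t
    · exact ⟨this.2, this.1⟩
    · exact ⟨this.2, this.1⟩
  · cases t <;> exact this

/-- The composition of two collapses on edges. -/
def compE (C : Collapse G H) (D : Collapse H K) (e : G.E) : Option (K.E × Bool) :=
  (C.onE e).bind fun a => (D.onE a.1).map fun b => (b.1, b.2 == a.2)

theorem compE_eq_some (C : Collapse G H) (D : Collapse H K) {e : G.E} {b : K.E} {r : Bool} :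
    C.compE D e = some (b, r) ↔
      ∃ a s t, C.onE e = some (a, s) ∧ D.onE a = some (b, t) ∧ r = (t == s) := by
  unfold compE
  rcases hC : C.onE e with _ | ⟨a, s⟩
  · simp
  · rcases hD : D.onE a with _ | ⟨b', t⟩
    · refine ⟨by simp [hD], ?_⟩
      rintro ⟨a', s', t', h1, h2, -⟩
      cases h1
      rw [hD] at h2
      cases h2
    · simp only [Option.bind_some, hD, Option.map_some, Option.some.injEq, Prod.mk.injEq]
      constructor
      · rintro ⟨rfl, rfl⟩; exact ⟨a, s, t, ⟨rfl, rfl⟩, by simp [hD], rfl⟩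
      · rintro ⟨a', s', t', ⟨rfl, rfl⟩, h, rfl⟩
        rw [hD] at h
        simp only [Option.some.injEq, Prod.mk.injEq] at h
        rw [h.1, h.2]; exact ⟨rfl, rfl⟩

theorem compE_eq_none (C : Collapse G H) (D : Collapse H K) {e : G.E} :
    C.compE D e = none ↔ C.onE e = none ∨ ∃ a s, C.onE e = some (a, s) ∧ D.onE a = none := by
  unfold compE
  rcases hC : C.onE e with _ | ⟨a, s⟩
  · simp
  · rcases hD : D.onE a with _ | ⟨b', t⟩
    · simp [hD]
    · simp [hD]

/-- This supplies the fibre condition for compositions: lift the path edge by edge and join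
consecutive lifts inside the fibres of `C`. -/
theorem exists_lifted_path (C : Collapse G H) (D : Collapse H K) {p : List (H.E × Bool)} {u v : G.V}
    (hp : H.IsPath (C.onV u) p (C.onV v)) (hpD : ∀ a ∈ p, D.onE a.1 = none) :
    ∃ q, G.IsPath u q v ∧ ∀ a ∈ q, C.compE D a.1 = none := by
  induction p generalizing u with
  | nil =>
    obtain ⟨q, hq, hqC⟩ := C.fiber u v hp
    exact ⟨q, hq, fun a ha => (C.compE_eq_none D).2 (Or.inl (hqC a ha))⟩
  | cons a p ih =>
    obtain ⟨a, s⟩ := a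
    obtain ⟨e, t, he⟩ := C.exists_onE_eq a
    have h := C.map_oriented he (t == s)
    have hts : (t == (t == s)) = s := by cases t <;> cases s <;> rfl
    rw [hts] at h
    obtain ⟨q1, hq1, hq1C⟩ := C.fiber u (G.start (e, t == s)) (hp.1.symm.trans h.1)
    obtain ⟨q2, hq2, hq2C⟩ := ih (u := G.finish (e, t == s)) (h.2 ▸ hp.2)
      fun b hb => hpD b (List.mem_cons_of_mem _ hb)
    refine ⟨q1 ++ (e, t == s) :: q2, hq1.append ⟨rfl, hq2⟩, fun b hb => ?_⟩
    rcases List.mem_append.1 hb with hb | hb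
    · exact (C.compE_eq_none D).2 (Or.inl (hq1C b hb))
    · rcases List.mem_cons.1 hb with rfl | hb
      · exact (C.compE_eq_none D).2 (Or.inr ⟨a, t, he, hpD (a, s) List.mem_cons_self⟩)
      · exact hq2C b hb

/-- Composition of collapses. -/
def comp (C : Collapse G H) (D : Collapse H K) : Collapse G K where
  onV v := D.onV (C.onV v)
  onE := C.compE D
  map_edge := by
    rintro e ⟨b, r⟩ h
    obtain ⟨a, s, t, h1, h2, rfl⟩ := (C.compE_eq_some D).1 h
    have h3 := C.map_edge e _ h1
    have h4 := D.map_oriented h2 s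
    exact ⟨h4.1.trans (by rw [h3.1]), h4.2.trans (by rw [h3.2])⟩
  map_collapsed := by
    intro e h
    rcases (C.compE_eq_none D).1 h with h | ⟨a, s, h1, h2⟩
    · rw [C.map_collapsed e h]
    · have h3 := C.map_edge e _ h1
      have h4 := D.map_collapsed a h2
      rw [← h3.1, ← h3.2]
      cases s
      · exact h4.symm
      · exact h4
  edge_bij := by
    intro b
    obtain ⟨a, t, h2⟩ := D.exists_onE_eq b
    obtain ⟨e, s, h1⟩ := C.exists_onE_eq a
    refine ⟨e, ⟨_, (C.compE_eq_some D).2 ⟨a, s, t, h1, h2, rfl⟩⟩, ?_⟩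
    rintro e' ⟨r, hr⟩
    obtain ⟨a', s', t', h3, h4, -⟩ := (C.compE_eq_some D).1 hr
    obtain rfl := D.onE_inj h2 h4
    exact C.onE_inj h3 h1
  surj := D.surj.comp C.surj
  fiber := by
    intro u v h
    obtain ⟨p, hp, hpD⟩ := D.fiber _ _ h
    exact C.exists_lifted_path D hp hpD

theorem comp_hom (C : Collapse G H) (D : Collapse H K) : (C.comp D).hom = D.hom.comp C.hom := by
  ext e
  rw [MonoidHom.comp_apply]
  rcases hC : C.onE e with _ | ⟨a, s⟩
  · rw [C.hom_of_none hC, _root_.map_one]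
    exact hom_of_none _ ((C.compE_eq_none D).2 (Or.inl hC))
  · rw [C.hom_of_some hC]
    rcases hD : D.onE a with _ | ⟨b, t⟩
    · rw [D.hom_singleton_of_none hD]
      exact hom_of_none _ ((C.compE_eq_none D).2 (Or.inr ⟨a, s, hC, hD⟩))
    · rw [D.hom_singleton_of_some hD]
      exact hom_of_some _ ((C.compE_eq_some D).2 ⟨a, s, t, hC, hD, rfl⟩)

theorem exists_path_image (C : Collapse G H) {p : List (G.E × Bool)} {u v : G.V} (hp : G.IsPath u p v) :
    ∃ q, H.IsPath (C.onV u) q (C.onV v) ∧ FreeGroup.mk q = C.hom (FreeGroup.mk p) := by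
  induction p generalizing u with
  | nil => exact ⟨[], congrArg C.onV hp, (_root_.map_one C.hom).symm⟩
  | cons a p ih =>
    obtain ⟨q, hq, hq'⟩ := ih hp.2
    obtain ⟨e, s⟩ := a
    rw [C.hom_mk_cons, ← hq']
    rcases hC : C.onE e with _ | ⟨a, t⟩
    · refine ⟨q, ?_, by rw [C.hom_singleton_of_none hC, one_mul]⟩
      have h := C.map_collapsed e hC
      have h0 := hp.1
      cases s
      · rw [← h0]; exact h.symm ▸ hq
      · rw [← h0]; exact h ▸ hq
    · have h := C.map_oriented hC s
      refine ⟨(a, t == s) :: q, ⟨h.1.trans (by rw [hp.1]), ?_⟩, ?_⟩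
      · rw [h.2]; exact hq
      · rw [C.hom_singleton_of_some hC, mul_mk]; rfl

/-- The trivial collapse. -/
protected def refl (G : FinGraph) : Collapse G G where
  onV v := v
  onE e := some (e, true)
  map_edge := by rintro e _ h; cases h; exact ⟨rfl, rfl⟩
  map_collapsed := by simp
  edge_bij e := ⟨e, ⟨true, rfl⟩, by rintro e' ⟨b, h⟩; cases h; rfl⟩
  surj := Function.surjective_id
  fiber u v h := ⟨[], h, by simp⟩

theorem refl_hom (G : FinGraph) : (Collapse.refl G).hom = MonoidHom.id _ := by
  ext e
  exact hom_of_some _ rfl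

/-- A collapse that collapses no edge is an isomorphism. -/
theorem exists_inverse (C : Collapse G H) (hC : ∀ e, C.onE e ≠ none) :
    ∃ D : Collapse H G, (∀ e, D.onE e ≠ none) ∧ D.hom.comp C.hom = MonoidHom.id _ := by
  have hinj : Function.Injective C.onV := by
    intro u v h
    obtain ⟨p, hp, hpC⟩ := C.fiber u v h
    cases p with
    | nil => exact hp
    | cons a p => exact absurd (hpC a List.mem_cons_self) (hC _)
  have hbij : Function.Bijective C.onV := ⟨hinj, C.surj⟩
  set i := Equiv.ofBijective C.onV hbij
  have hi : ∀ v, i.symm (C.onV v) = v := fun v => i.symm_apply_apply v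
  choose k s hk using C.exists_onE_eq
  have hk' : ∀ e a t, C.onE e = some (a, t) → k a = e ∧ s a = t := by
    intro e a t h
    have h1 := C.onE_inj (hk a) h
    refine ⟨h1, ?_⟩
    have h2 := hk a
    rw [h1, h] at h2
    simpa using h2.symm
  refine ⟨⟨i.symm, fun a => some (k a, s a), ?_, ?_, ?_, i.symm.surjective, ?_⟩, by simp, ?_⟩
  · rintro a _ ⟨⟩
    have h := C.map_edge _ _ (hk a)
    rcases hs : s a with _ | _
    · rw [hs] at h
      refine ⟨?_, ?_⟩
      · rw [show H.src a = H.finish (a, false) from rfl, h.2, hi]; rfl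
      · rw [show H.tgt a = H.start (a, false) from rfl, h.1, hi]; rfl
    · rw [hs] at h
      refine ⟨?_, ?_⟩
      · rw [show H.src a = H.start (a, true) from rfl, h.1, hi]; rfl
      · rw [show H.tgt a = H.finish (a, true) from rfl, h.2, hi]; rfl
  · simp
  · intro e
    obtain ⟨⟨a, t⟩, h⟩ := Option.ne_none_iff_exists'.1 (hC e)
    have h1 := hk' e a t h
    refine ⟨a, ⟨t, by simp [h1.1, h1.2]⟩, ?_⟩
    rintro a' ⟨b, hb⟩
    simp only [Option.some.injEq, Prod.mk.injEq] at hb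
    have h2 := hk a'
    rw [hb.1, h] at h2
    simp only [Option.some.injEq, Prod.mk.injEq] at h2
    exact h2.1.symm
  · intro u v h
    exact ⟨[], i.symm.injective h, by simp⟩
  · ext e
    rw [MonoidHom.comp_apply, MonoidHom.id_apply]
    obtain ⟨⟨a, t⟩, h⟩ := Option.ne_none_iff_exists'.1 (hC e)
    have h1 := hk' e a t h
    rw [C.hom_of_some h]
    refine (hom_singleton_of_some _ (e' := k a) (t := s a) rfl).trans ?_
    rw [h1.1, h1.2]
    cases t <;> rfl

end Collapse

namespace MarkedGraph

open FreeGroup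

variable {n : ℕ} {G H R : MarkedGraph n}

theorem Equivalent.refl (G : MarkedGraph n) : G.Equivalent G :=
  ⟨Collapse.refl _, by simp [Collapse.refl], [], rfl, fun w => by
    rw [Collapse.refl_hom, ← one_eq_mk]; simp⟩

theorem Equivalent.symm (h : G.Equivalent H) : H.Equivalent G := by
  obtain ⟨C, hC, p, hp, hw⟩ := h
  obtain ⟨D, hD, hDC⟩ := C.exists_inverse hC
  -- the collapse `D` maps the track of the base point back to `G`
  obtain ⟨r, hr, hr'⟩ := D.exists_path_image hp
  have hDC' : ∀ x, D.hom (C.hom x) = x := fun x => DFunLike.congr_fun hDC x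
  -- The identity is known only on words in the edges. It is read off at the base vertex from an
  -- edge starting there, which exists because valences are at least three.
  have hV : D.onV (C.onV G.base) = G.base := by
    obtain ⟨a, ha⟩ : ∃ a : G.E × Bool, G.start a = G.base := by
      have h3 := G.three_le_valence G.base
      have : Nonempty {a : G.E × Bool // G.start a = G.base} := by
        by_contra hne
        rw [not_nonempty_iff] at hne
        rw [FinGraph.valence, Nat.card_of_isEmpty] at h3
        omega
      exact ⟨this.some.1, this.some.2⟩
    obtain ⟨e, s⟩ := a
    obtain ⟨⟨b, t⟩, hb⟩ := Option.ne_none_iff_exists'.1 (hC e)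
    obtain ⟨⟨e', t'⟩, he'⟩ := Option.ne_none_iff_exists'.1 (hD b)
    have h1 := C.map_oriented hb s
    have h2 := D.map_oriented he' (t == s)
    have h3 := hDC' (FreeGroup.mk [(e, s)])
    rw [C.hom_singleton_of_some hb, D.hom_singleton_of_some he'] at h3
    have h4 := IsReduced.singleton.eq_of_mk_eq IsReduced.singleton h3
    rw [← ha, ← h1.1, ← h2.1]
    rw [List.cons.injEq] at h4
    rw [h4.1]
  rw [hV] at hr
  refine ⟨D, hD, invRev r, hr.invRev, fun w => ?_⟩
  rw [hw, _root_.map_mul, _root_.map_mul, hDC', _root_.map_inv, ← inv_mk, hr']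
  group

theorem IsFace.trans_equivalent (hRH : R.IsFace H) (h : G.Equivalent H) : R.IsFace G := by
  obtain ⟨C, -, p, hp, hw⟩ := h
  obtain ⟨D, q, hq, hw'⟩ := hRH
  obtain ⟨r, hr, hr'⟩ := D.exists_path_image hp
  refine ⟨C.comp D, q ++ r, hq.append hr, fun w => ?_⟩
  rw [hw', hw, Collapse.comp_hom, MonoidHom.comp_apply, ← mul_mk, hr']
  simp only [_root_.map_mul, _root_.map_inv]
  group

theorem Equivalent.roseFaces_eq (h : G.Equivalent H) : H.roseFaces = G.roseFaces :=
  Set.ext fun _ => ⟨fun hR => ⟨hR.1, hR.2.trans_equivalent h⟩,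
    fun hR => ⟨hR.1, hR.2.trans_equivalent h.symm⟩⟩

/-! ### The rose of a spanning tree -/

section rose

variable (G) (T : Set G.E)

/-- The graph with one vertex whose edges are the edges outside of `T`. -/
def roseGraph : FinGraph where
  V := Unit
  E := {e : G.E // e ∉ T}
  finV := inferInstance
  finE := have := G.finE; inferInstance
  src _ := ()
  tgt _ := ()

variable {G T}

open Classical in
/-- The collapse of a spanning tree. -/
noncomputable def roseCollapse (hT : G.IsSpanningTree T) : Collapse G.toFinGraph (G.roseGraph T) where
  onV _ := ()
  onE e := if h : e ∈ T then none else some (⟨e, h⟩, true)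
  map_edge _ _ _ := ⟨rfl, rfl⟩
  map_collapsed _ _ := rfl
  edge_bij e := by
    refine ⟨e.1, ⟨true, dif_neg e.2⟩, ?_⟩
    rintro e' ⟨b, h⟩
    by_cases h' : e' ∈ T
    · rw [dif_pos h'] at h; simp at h
    · rw [dif_neg h'] at h
      cases h
      rfl
  surj _ := ⟨G.base, rfl⟩
  fiber u v _ := by
    obtain ⟨p, hp, hpT⟩ := hT.2 u v
    exact ⟨p, hp, fun a ha => dif_pos (hpT a ha)⟩

theorem roseCollapse_onE_eq_none (hT : G.IsSpanningTree T) {e : G.E} :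
    (roseCollapse hT).onE e = none ↔ e ∈ T := by
  simp [roseCollapse]

theorem roseCollapse_onE (hT : G.IsSpanningTree T) {e : G.E} (h : e ∉ T) :
    (roseCollapse hT).onE e = some (⟨e, h⟩, true) := dif_neg h

theorem _root_.FinGraph.IsForest.mk_eq_one {G : FinGraph} {T : Set G.E} (hT : G.IsForest T)
    {v : G.V} {p : List (G.E × Bool)} (h : G.IsPath v p v) (hpT : ∀ a ∈ p, a.1 ∈ T) :
    FreeGroup.mk p = 1 := by
  classical
  rw [← reduce.self, hT.eq_nil h.reduce (isReduced_reduce p)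
    fun a ha => hpT a (reduce.red.sublist.subset ha), one_eq_mk]

/-- The inverse `Φ` sends a petal to its edge, joined to the base point at both ends by tree paths
`τ`. Along a path from `u` to `v` the tree paths cancel at all inner vertices; for loops at the base
point the outer ones are trivial too. -/
theorem roseCollapse_injOn (hT : G.IsSpanningTree T) {g : FreeGroup G.E}
    (hg : g ∈ G.fundGroup G.base) (h : (roseCollapse hT).hom g = 1) : g = 1 := by
  choose τ hτ hτT using hT.2 G.base
  set Φ : FreeGroup (G.roseGraph T).E →* FreeGroup G.E :=
    lift fun e => FreeGroup.mk (τ (G.src e.1)) * of e.1 * (FreeGroup.mk (τ (G.tgt e.1)))⁻¹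
  have key : ∀ (p : List (G.E × Bool)) (u v : G.V), G.IsPath u p v →
      Φ ((roseCollapse hT).hom (FreeGroup.mk p)) =
        FreeGroup.mk (τ u) * FreeGroup.mk p * (FreeGroup.mk (τ v))⁻¹ := by
    intro p
    induction p with
    | nil =>
      intro u v huv
      have h0 : (FreeGroup.mk [] : FreeGroup G.E) = 1 := rfl
      rw [FinGraph.isPath_nil.1 huv, h0, _root_.map_one, _root_.map_one]
      group
    | cons a p ih =>
      intro u v huv
      rw [Collapse.hom_mk_cons, _root_.map_mul, ih _ _ huv.2]
      have hone : Φ ((roseCollapse hT).hom (FreeGroup.mk [a])) =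
          FreeGroup.mk (τ (G.start a)) * FreeGroup.mk [a] * (FreeGroup.mk (τ (G.finish a)))⁻¹ := by
        by_cases ha : a.1 ∈ T
        · rw [Collapse.hom_singleton_of_none _ ((roseCollapse_onE_eq_none hT).2 ha),
            _root_.map_one, mul_mk, inv_mk, mul_mk]
          refine (hT.1.mk_eq_one (((hτ _).append
            (show G.IsPath (G.start a) [a] (G.finish a) from ⟨rfl, rfl⟩)).append (hτ _).invRev) ?_).symm
          intro b hb
          rcases List.mem_append.1 hb with hb | hb
          · rcases List.mem_append.1 hb with hb | hb
            · exact hτT _ b hb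
            · rw [List.mem_singleton.1 hb]; exact ha
          · exact hτT _ (b.1, !b.2) (mem_invRev.1 hb)
        · obtain ⟨e, s⟩ := a
          rw [Collapse.hom_singleton_of_some _ (roseCollapse_onE hT ha)]
          cases s
          · let d : (G.roseGraph T).E := ⟨e, ha⟩
            have h5 : Φ (FreeGroup.mk [(d, false)]) = (Φ (of d))⁻¹ := by
              rw [mk_singleton_false, _root_.map_inv]
            have h6 : Φ (of d) = FreeGroup.mk (τ (G.src e)) * of e *
                (FreeGroup.mk (τ (G.tgt e)))⁻¹ := lift_apply_of
            refine h5.trans ?_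
            rw [h6, mk_singleton_false, mul_inv_rev, mul_inv_rev, inv_inv, ← mul_assoc]
            rfl
          · exact lift_apply_of
      rw [hone, huv.1]
      have : (FreeGroup.mk (a :: p) : FreeGroup G.E) = FreeGroup.mk [a] * FreeGroup.mk p := by
        rw [mul_mk]; rfl
      rw [this]
      group
  obtain ⟨p, hp, rfl⟩ := hg
  have h1 := key p _ _ hp
  rw [h, _root_.map_one, hT.1.mk_eq_one (hτ G.base) (hτT G.base)] at h1
  simpa using h1.symm

theorem roseCollapse_surjOn (hT : G.IsSpanningTree T) (x : FreeGroup (G.roseGraph T).E) :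
    ∃ w, (roseCollapse hT).hom (G.mark w) = x := by
  have hle : (⊤ : Subgroup (FreeGroup (G.roseGraph T).E)) ≤
      ((roseCollapse hT).hom.comp G.mark).range := by
    rw [← closure_range_of, Subgroup.closure_le]
    rintro _ ⟨e, rfl⟩
    obtain ⟨p, hp, hpT⟩ := hT.2 G.base (G.src e.1)
    obtain ⟨q, hq, hqT⟩ := hT.2 (G.tgt e.1) G.base
    have h1 : G.IsPath G.base (p ++ (e.1, true) :: q) G.base := hp.append ⟨rfl, hq⟩
    have h2 := FinGraph.mk_mem_fundGroup h1
    rw [← G.mark_range] at h2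
    obtain ⟨w, hw⟩ := h2
    refine ⟨w, ?_⟩
    rw [MonoidHom.comp_apply, hw, Collapse.hom_mk_append, Collapse.hom_mk_cons,
      Collapse.hom_mk_of_collapsed _ fun a ha => (roseCollapse_onE_eq_none hT).2 (hpT a ha),
      Collapse.hom_mk_of_collapsed _ fun a ha => (roseCollapse_onE_eq_none hT).2 (hqT a ha),
      Collapse.hom_singleton_of_some _ (roseCollapse_onE hT e.2), one_mul, mul_one]
    rfl
  exact hle (Subgroup.mem_top x)

theorem rose_mark_injective (hT : G.IsSpanningTree T) :
    Function.Injective ((roseCollapse hT).hom.comp G.mark) := by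
  rw [injective_iff_map_eq_one]
  intro w hw
  exact G.mark_injective ((roseCollapse_injOn hT (G.mark_mem w) hw).trans (_root_.map_one _).symm)

/-- Collapsing a spanning tree produces a rose-face. -/
theorem exists_rose (hn : 2 ≤ n) (hT : G.IsSpanningTree T) :
    ∃ R : MarkedGraph n, R ∈ G.roseFaces ∧ ∃ C : Collapse G.toFinGraph R.toFinGraph,
      Respects C ∧ ∀ e, C.onE e = none ↔ e ∈ T := by
  have hpath : ∀ p, (G.roseGraph T).IsPath () p () := by
    intro p
    induction p with
    | nil => rfl
    | cons a p ih => exact ⟨rfl, ih⟩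
  have hcard : Nat.card (G.roseGraph T).E = n := by
    have e := MulEquiv.ofBijective ((roseCollapse hT).hom.comp G.mark)
      ⟨rose_mark_injective hT, roseCollapse_surjOn hT⟩
    rw [← Nat.card_congr (Equiv.ofFreeGroupEquiv e), Nat.card_eq_fintype_card, Fintype.card_fin]
  refine ⟨⟨G.roseGraph T, fun _ _ => ⟨[], rfl⟩, fun v => ?_, (),
    (roseCollapse hT).hom.comp G.mark, rose_mark_injective hT, ?_⟩, ⟨fun _ => rfl, ?_⟩, ?_⟩
  -- Each of the `n` petals has two germs at the vertex, so the valence is `2 * n`, at least three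
  -- because `2 ≤ n`.
  · have : (G.roseGraph T).valence v = Nat.card ((G.roseGraph T).E × Bool) :=
      Nat.card_congr (Equiv.subtypeUnivEquiv fun _ => rfl)
    rw [this, Nat.card_prod, hcard]
    simp only [Nat.card_eq_fintype_card, Fintype.card_bool]
    omega
  · refine le_antisymm ?_ ?_
    · classical
      rintro _ ⟨w, rfl⟩
      exact ⟨toWord _, hpath _, mk_toWord⟩
    · intro x _
      exact roseCollapse_surjOn hT x
  · exact ⟨roseCollapse hT, [], rfl, fun w => by rw [← one_eq_mk]; simp⟩
  · exact ⟨roseCollapse hT, ⟨[], rfl, fun w => by rw [← one_eq_mk]; simp⟩,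
      fun e => roseCollapse_onE_eq_none hT⟩

end rose

end MarkedGraph

/-! ## Loops crossing a given edge most efficiently -/

namespace FreeGroup

/-- The blocks `a s b` and `b s⁻¹ a` repeat no edge, hence are reduced. Overlapping them along the
nonempty blocks `b` and `a` shows that the square of the barbell word is reduced. -/
theorem isCyclicallyReduced_barbell {α : Type*} {a s b : List (α × Bool)}
    (h : ((a ++ s ++ b).map Prod.fst).Nodup) (ha : a ≠ []) (hb : b ≠ []) :
    IsCyclicallyReduced (a ++ s ++ b ++ invRev s) := by
  have hperm : ((b ++ invRev s ++ a).map Prod.fst).Perm ((a ++ s ++ b).map Prod.fst) := by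
    simp only [List.map_append, map_fst_invRev]
    refine List.perm_append_comm.trans ?_
    rw [List.append_assoc]
    refine List.Perm.append_left _ (List.perm_append_comm.trans ?_)
    exact (List.reverse_perm _).append_right _
  have h1 : IsReduced (a ++ s ++ b) := isReduced_of_nodup h
  have h2 : IsReduced (b ++ invRev s ++ a) := isReduced_of_nodup (hperm.nodup_iff.2 h)
  have h3 : IsReduced ((a ++ s) ++ b ++ (invRev s ++ a)) :=
    IsReduced.append_overlap h1 (by rwa [List.append_assoc] at h2) hb
  have h4 : IsReduced ((a ++ s ++ b ++ invRev s) ++ a ++ (s ++ b ++ invRev s)) := by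
    refine IsReduced.append_overlap (by simpa only [List.append_assoc] using h3) ?_ ha
    exact h3.infix ⟨[], a, by simp⟩
  exact isCyclicallyReduced_of_append_self (by simpa only [List.append_assoc] using h4)

end FreeGroup

/-- The sets `A` and `B` will be the lengths of turns at the two ends of an edge. A bound on every
sum `a + b` becomes separate bounds whose corrections `δ` and `-δ` cancel. -/
theorem exists_shift {A B : Set ℝ} {D : ℝ} (hA : ∀ a ∈ A, 0 ≤ a) (hB : ∀ b ∈ B, 0 ≤ b)
    (h : ∀ a ∈ A, ∀ b ∈ B, 2 * D ≤ a + b) :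
    ∃ δ, (∀ a ∈ A, D + δ ≤ a) ∧ ∀ b ∈ B, D - δ ≤ b := by
  rcases A.eq_empty_or_nonempty with rfl | hne
  · exact ⟨D, by simp, fun b hb => by simpa using hB b hb⟩
  · refine ⟨sInf A - D, fun a ha => ?_, fun b hb => ?_⟩
    · have := csInf_le ⟨0, hA⟩ ha
      linarith
    · have : 2 * D - b ≤ sInf A := le_csInf hne fun a ha => by linarith [h a ha b hb]
      linarith

namespace MarkedGraph

open FreeGroup

variable {n : ℕ} {G : MarkedGraph n}

theorem IsSimpleLoop.crossings_eq {w : FreeGroup (Fin n)} {v : G.V} {c : List (G.E × Bool)}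
    (hc : G.IsSimpleClosedPath v c) (h : G.Represents c w) {k : G.E}
    (hk : k ∈ c.map Prod.fst) : G.crossings k w = 1 := by
  have := h.transLen_eq (indicator_nonneg k) hc.isCyclicallyReduced
  rw [← crossings_eq_transLen, weight_indicator_eq_one hc.2.2.2 hk] at this
  exact_mod_cast this

/-- Only the connecting path is traversed twice. The length bound leaves finitely many classes, so
that minima over almost simple loops are attained. -/
theorem IsAlmostSimpleLoop.exists_short {w : FreeGroup (Fin n)} (h : G.IsAlmostSimpleLoop w) :
    ∃ p, p.length ≤ 2 * Nat.card G.E ∧ G.Represents p w := by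
  have := G.finE
  have := Fintype.ofFinite G.E
  rw [Nat.card_eq_fintype_card]
  rcases h with ⟨v, p, hp, hw⟩ | ⟨u, v, α, s, β, hb, hw⟩
  · refine ⟨p, ?_, hw⟩
    have := hp.2.2.2.length_le_card
    rw [List.length_map] at this
    omega
  · refine ⟨_, ?_, hw⟩
    have := hb.2.2.2.2.length_le_card
    simp only [List.length_map, List.length_append, invRev_length] at this ⊢
    omega

end MarkedGraph

namespace MarkedMetricGraph

open FreeGroup MarkedGraph

variable {n : ℕ} (X : MarkedMetricGraph n) {k : X.graph.E} {c : ℝ}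

theorem len_nonneg (e : X.graph.E) : 0 ≤ X.len e := (X.len_pos e).le

/-- The ratios of length and number of crossings of an edge `k`, for the almost simple loops
that cross `k`. -/
def crossingRatios (k : X.graph.E) : Set ℝ :=
  {r | ∃ σ : FreeGroup (Fin n), X.graph.IsAlmostSimpleLoop σ ∧
    0 < X.graph.crossings k σ ∧ r = X.loopLen σ / X.graph.crossings k σ}

theorem finite_crossingRatios (k : X.graph.E) : (X.crossingRatios k).Finite := by
  have := X.graph.finE
  refine ((List.finite_length_le (X.graph.E × Bool) (2 * Nat.card X.graph.E)).image fun p =>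
    transLen X.len (FreeGroup.mk p) / transLen (indicator k) (FreeGroup.mk p)).subset ?_
  rintro _ ⟨σ, hσ, -, rfl⟩
  obtain ⟨p, hp, hpσ⟩ := hσ.exists_short
  refine ⟨p, hp, ?_⟩
  simp only
  rw [transLen_eq_of_isConj X.len_nonneg hpσ, transLen_eq_of_isConj (indicator_nonneg k) hpσ,
    crossings_eq_transLen, loopLen_eq_transLen]

variable {X}

theorem le_of_mem_lowerBounds (hc : c ∈ lowerBounds (X.crossingRatios k)) {σ : FreeGroup (Fin n)}
    (hσ : X.graph.IsAlmostSimpleLoop σ) (hk : 0 < X.graph.crossings k σ) :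
    c * X.graph.crossings k σ ≤ X.loopLen σ := by
  have := hc ⟨σ, hσ, hk, rfl⟩
  rwa [le_div_iff₀ (by exact_mod_cast hk)] at this

/-- An arc contained in the return path closes up with `a` to a circle crossing `k` once. -/
theorem le_of_return (hc : c ∈ lowerBounds (X.crossingRatios k)) {a : X.graph.E × Bool}
    (ha : a.1 = k) {l : List (X.graph.E × Bool)}
    (hl : X.graph.IsPath (X.graph.finish a) l (X.graph.start a)) (hk : k ∉ l.map Prod.fst) :
    c ≤ X.len k + weight X.len l := by
  obtain ⟨q, hq, hqn, hql⟩ := hl.exists_arc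
  have hs := FinGraph.IsSimpleClosedPath.of_arc hq hqn
    (fun h => hk (ha ▸ (hql.map Prod.fst).subset h))
  obtain ⟨σ, hσ⟩ := exists_represents hs.2.1
  have h1 := IsSimpleLoop.crossings_eq (k := k) hs hσ (by simp [ha])
  have h2 := le_of_mem_lowerBounds hc (Or.inl ⟨_, _, hs, hσ⟩) (by rw [h1]; norm_num)
  rw [h1, loopLen_eq_transLen, hσ.transLen_eq X.len_nonneg hs.isCyclicallyReduced, weight_cons,
    ha] at h2
  have h3 := weight_le_of_sublist X.len_nonneg hql
  push_cast at h2
  linarith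

/-- Disjoint lollipops at the two ends of `k` are joined by `k` to a barbell crossing `k` twice. If
they share a vertex, two return paths through it use each stick at most twice and each circle at
most once in total. -/
theorem le_of_two_lollipops (hc : c ∈ lowerBounds (X.crossingRatios k)) {a : X.graph.E × Bool}
    (ha : a.1 = k) {x y : X.graph.V} {s₁ c₁ s₂ c₂ : List (X.graph.E × Bool)}
    (hs₁ : X.graph.IsPath (X.graph.finish a) s₁ x) (hc₁ : X.graph.IsSimpleClosedPath x c₁)
    (hn₁ : ((s₁ ++ c₁).map X.graph.start).Nodup) (he₁ : ((s₁ ++ c₁).map Prod.fst).Nodup)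
    (hk₁ : k ∉ (s₁ ++ c₁).map Prod.fst)
    (hs₂ : X.graph.IsPath (X.graph.start a) s₂ y) (hc₂ : X.graph.IsSimpleClosedPath y c₂)
    (hn₂ : ((s₂ ++ c₂).map X.graph.start).Nodup) (he₂ : ((s₂ ++ c₂).map Prod.fst).Nodup)
    (hk₂ : k ∉ (s₂ ++ c₂).map Prod.fst) :
    2 * c ≤ 2 * X.len k + (2 * weight X.len s₁ + weight X.len c₁) +
      (2 * weight X.len s₂ + weight X.len c₂) := by
  by_cases hdisj : ∃ z, z ∈ (s₁ ++ c₁).map X.graph.start ∧ z ∈ (s₂ ++ c₂).map X.graph.start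
  · obtain ⟨z, h1, h2⟩ := hdisj
    obtain ⟨d₁, hd₁, rfl⟩ := List.mem_map.1 h1
    obtain ⟨d₂, hd₂, hdd⟩ := List.mem_map.1 h2
    obtain ⟨p₁, p₂, hp⟩ := List.append_of_mem hd₁
    obtain ⟨q₁, q₂, hq⟩ := List.append_of_mem hd₂
    have hp' := hs₁.append hc₁.2.1
    have hq' := hs₂.append hc₂.2.1
    rw [hp] at hp' hk₁
    rw [hq] at hq' hk₂
    obtain ⟨z₁, hp₁, hp₂⟩ := FinGraph.isPath_append.1 hp'
    obtain ⟨z₂, hq₁, hq₂⟩ := FinGraph.isPath_append.1 hq'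
    obtain rfl : z₁ = X.graph.start d₁ := hp₂.1.symm
    obtain rfl : z₂ = X.graph.start d₁ := hq₂.1.symm.trans hdd
    have hks₁ : k ∉ s₁.map Prod.fst := fun h => hk₁ (by
      rw [← hp, List.map_append]; exact List.mem_append_left _ h)
    have hks₂ : k ∉ s₂.map Prod.fst := fun h => hk₂ (by
      rw [← hq, List.map_append]; exact List.mem_append_left _ h)
    rw [List.map_append, List.mem_append, not_or] at hk₁ hk₂
    -- The first return path follows the initial segments `p₁`, `q₁` up to the common vertex; the
    -- second follows `s₁`, `s₂` and the remainders `p₂`, `q₂`. Their lengths add up exactly to the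
    -- bound.
    have e1 := le_of_return hc ha (hp₁.append hq₁.invRev) (by
      rw [List.map_append, map_fst_invRev, List.mem_append, List.mem_reverse]
      exact not_or.2 ⟨hk₁.1, hk₂.1⟩)
    have e2 := le_of_return hc ha ((hp₂.append hs₁.invRev).invRev.append (hq₂.append hs₂.invRev))
      (by
        simp only [List.map_append, map_fst_invRev, List.mem_append, List.mem_reverse, not_or]
        exact ⟨⟨hk₁.2, hks₁⟩, hk₂.2, hks₂⟩)
    have w1 := congrArg (weight X.len) hp
    have w2 := congrArg (weight X.len) hq
    simp only [weight_append, weight_invRev] at e1 e2 w1 w2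
    linarith
  · push Not at hdisj
    obtain ⟨e, t⟩ := a
    obtain rfl : e = k := ha
    -- The bar of the barbell: back along the first stick, across `k` against the direction of `a`,
    -- and out along the second stick.
    set s := invRev s₁ ++ (e, !t) :: s₂ with hs
    have hsp : X.graph.IsPath x s y := by
      refine hs₁.invRev.append ⟨FinGraph.start_not e t, ?_⟩
      rw [FinGraph.finish_not]
      exact hs₂
    have hedisj : ∀ d ∈ (s₁ ++ c₁).map Prod.fst, d ∉ (s₂ ++ c₂).map Prod.fst := by
      intro d hd1 hd2
      obtain ⟨d₁, hd₁, rfl⟩ := List.mem_map.1 hd1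
      obtain ⟨d₂, hd₂, hdd⟩ := List.mem_map.1 hd2
      refine hdisj _ (List.mem_map_of_mem hd₁) ?_
      have h1 := (hs₂.append hc₂.2.1).endpoint_mem hd₂ hdd
      rcases List.mem_append.1 h1 with h1 | h1
      · exact h1
      · rw [List.mem_singleton.1 h1]
        obtain ⟨b, c₂', rfl⟩ := List.exists_cons_of_ne_nil hc₂.1
        rw [← hc₂.2.1.1]
        exact List.mem_map_of_mem (by simp)
    have hedges : ((c₁ ++ s ++ c₂).map Prod.fst).Nodup := by
      have hperm : ((c₁ ++ s ++ c₂).map Prod.fst).Perm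
          (e :: ((s₁ ++ c₁).map Prod.fst ++ (s₂ ++ c₂).map Prod.fst)) := by
        simp only [hs, List.map_append, map_fst_invRev, List.map_cons, ← Multiset.coe_eq_coe,
          ← Multiset.coe_add, ← Multiset.cons_coe, Multiset.coe_reverse,
          ← Multiset.singleton_add]
        abel
      rw [hperm.nodup_iff, List.nodup_cons, List.mem_append, not_or, List.nodup_append]
      exact ⟨⟨hk₁, hk₂⟩, he₁, he₂, fun a h1 b h2 hab => hedisj a h1 (hab ▸ h2)⟩
    have hvert : (c₁.map X.graph.start ++ s.map X.graph.finish ++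
        (c₂.map X.graph.start).tail).Nodup := by
      have hfin : X.graph.start (e, t) :: s₂.map X.graph.finish =
          s₂.map X.graph.start ++ [y] := hs₂.cons_map_finish
      have htail : c₂.map X.graph.start = y :: (c₂.map X.graph.start).tail := by
        obtain ⟨b, c₂', rfl⟩ := List.exists_cons_of_ne_nil hc₂.1
        rw [← hc₂.2.1.1]; rfl
      have hperm : (c₁.map X.graph.start ++ s.map X.graph.finish ++
          (c₂.map X.graph.start).tail).Perm
          ((s₁ ++ c₁).map X.graph.start ++ (s₂ ++ c₂).map X.graph.start) := by
        rw [hs, List.map_append, List.map_cons, FinGraph.finish_not, hfin,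
          FinGraph.map_finish_invRev, List.map_append, List.map_append, htail, List.tail_cons]
        simp only [← Multiset.coe_eq_coe, ← Multiset.coe_add, Multiset.coe_reverse,
          ← Multiset.cons_coe, ← Multiset.singleton_add, Multiset.coe_nil, add_zero]
        abel
      rw [hperm.nodup_iff, List.nodup_append]
      exact ⟨hn₁, hn₂, fun a h1 b h2 hab => hdisj a h1 (hab ▸ h2)⟩
    have hb : X.graph.IsEmbeddedBarbell x y c₁ s c₂ := ⟨hc₁, hsp, hc₂, hvert, hedges⟩
    obtain ⟨σ, hσ⟩ := exists_represents
      (((hc₁.2.1.append hsp).append hc₂.2.1).append hsp.invRev)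
    have hred := isCyclicallyReduced_barbell hedges hc₁.1 hc₂.1
    have hcr : (X.graph.crossings e σ : ℝ) = 2 := by
      rw [List.map_append, List.mem_append, not_or] at hk₁ hk₂
      rw [crossings_eq_transLen, hσ.transLen_eq (indicator_nonneg e) hred]
      simp only [hs, weight_append, weight_invRev, weight_cons, indicator_self,
        weight_indicator_eq_zero hk₁.1, weight_indicator_eq_zero hk₁.2,
        weight_indicator_eq_zero hk₂.1, weight_indicator_eq_zero hk₂.2]
      norm_num
    have h2 := le_of_mem_lowerBounds hc (Or.inr ⟨_, _, _, _, _, hb, hσ⟩)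
      (by have : (0 : ℝ) < X.graph.crossings e σ := by rw [hcr]; norm_num
          exact_mod_cast this)
    rw [hcr, loopLen_eq_transLen, hσ.transLen_eq X.len_nonneg hred] at h2
    simp only [hs, weight_append, weight_invRev, weight_cons] at h2
    linarith

/-- Each turn contains a lollipop whose loop is no longer than the turn. -/
theorem le_of_two_turns (hc : c ∈ lowerBounds (X.crossingRatios k)) {a : X.graph.E × Bool}
    (ha : a.1 = k) {p q : List (X.graph.E × Bool)}
    (hp : X.graph.IsPath (X.graph.finish a) p (X.graph.finish a)) (hpr : IsReduced p)
    (hp0 : p ≠ []) (hkp : k ∉ p.map Prod.fst)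
    (hq : X.graph.IsPath (X.graph.start a) q (X.graph.start a)) (hqr : IsReduced q)
    (hq0 : q ≠ []) (hkq : k ∉ q.map Prod.fst) :
    2 * (c - X.len k) ≤ weight X.len p + weight X.len q := by
  obtain ⟨x, s₁, c₁, h1, h2, h3, h4, h5, h6⟩ := hp.exists_lollipop X.len_nonneg hpr hp0
  obtain ⟨y, s₂, c₂, g1, g2, g3, g4, g5, g6⟩ := hq.exists_lollipop X.len_nonneg hqr hq0
  have := le_of_two_lollipops hc ha h1 h2 h3 h4
    (fun h => by obtain ⟨b, hb, hbk⟩ := List.mem_map.1 h; exact hkp (hbk ▸ h5 b hb)) g1 g2 g3 g4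
    (fun h => by obtain ⟨b, hb, hbk⟩ := List.mem_map.1 h; exact hkq (hbk ▸ g5 b hb))
  linarith

/-- Between two crossings of `k`, a path without backtracking spends on average at least the
minimal ratio per crossing, up to a term that depends on the directions of these crossings. -/
theorem exists_potential (hc : c ∈ lowerBounds (X.crossingRatios k)) :
    ∃ φ : Bool → ℝ, ∀ (l : List (X.graph.E × Bool)) (s t : Bool),
      X.graph.IsPath (X.graph.finish (k, s)) l (X.graph.start (k, t)) →
      IsReduced ((k, s) :: l ++ [(k, t)]) →
      c * (weight (indicator k) l + 1) + φ s - φ t ≤ weight X.len l + X.len k := by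
  set S : X.graph.V → Set ℝ := fun v => {r | ∃ p, X.graph.IsPath v p v ∧ IsReduced p ∧ p ≠ [] ∧
    k ∉ p.map Prod.fst ∧ r = weight X.len p} with hS
  have hpos : ∀ v, ∀ r ∈ S v, 0 ≤ r := by
    rintro v _ ⟨p, -, -, -, -, rfl⟩
    exact weight_nonneg X.len_nonneg p
  obtain ⟨δ, hA, hB⟩ := exists_shift (D := c - X.len k) (hpos (X.graph.finish (k, true)))
    (hpos (X.graph.start (k, true))) (by
      rintro _ ⟨p, h1, h2, h3, h4, rfl⟩ _ ⟨q, g1, g2, g3, g4, rfl⟩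
      exact le_of_two_turns hc rfl h1 h2 h3 h4 g1 g2 g3 g4)
  -- A turn at the terminal end changes the direction from `true` to `false` and gains `δ`; a turn
  -- at the initial end loses `δ`. If `l` crosses `k`, it is split there and the potentials
  -- telescope.
  refine ⟨fun s => if s then δ / 2 else -(δ / 2), fun l => ?_⟩
  induction hN : l.length using Nat.strong_induction_on generalizing l with
  | _ N ih =>
  intro s t hl hr
  by_cases hk : k ∈ l.map Prod.fst
  · obtain ⟨⟨e, r⟩, ha, rfl⟩ := List.mem_map.1 hk
    obtain ⟨l₁, l₂, rfl⟩ := List.append_of_mem ha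
    obtain ⟨x, h1, h2⟩ := FinGraph.isPath_append.1 hl
    obtain rfl : x = X.graph.start (e, r) := h2.1.symm
    simp only [List.length_append, List.length_cons] at hN
    have i1 := ih l₁.length (by omega) l₁ rfl s r h1 (hr.infix ⟨[], l₂ ++ [(e, t)], by simp⟩)
    have i2 := ih l₂.length (by omega) l₂ rfl r t h2.2 (hr.infix ⟨(e, s) :: l₁, [], by simp⟩)
    simp only [weight_append, weight_cons, indicator_self]
    simp only at i1 i2
    linarith
  · rw [weight_indicator_eq_zero hk]
    have hlr : IsReduced l := hr.infix ⟨[(k, s)], [(k, t)], by simp⟩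
    -- An empty piece between opposite crossings would be a backtrack.
    have hl0 : s ≠ t → l ≠ [] := by
      rintro hst rfl
      rw [List.cons_append, List.nil_append, isReduced_cons_cons] at hr
      exact hst (hr.1 rfl)
    cases s <;> cases t
    · have := le_of_return hc (a := (k, false)) rfl hl hk
      simp only
      linarith
    · have := hB _ ⟨l, hl, hlr, hl0 (by simp), hk, rfl⟩
      simp only [Bool.false_eq_true, if_false, if_true]
      linarith
    · have := hA _ ⟨l, hl, hlr, hl0 (by simp), hk, rfl⟩
      simp only [Bool.false_eq_true, if_false, if_true]
      linarith
    · have := le_of_return hc (a := (k, true)) rfl hl hk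
      simp only
      linarith

/-- Among all loops, almost simple ones minimise the ratio of length and number of crossings
of an edge. -/
theorem mul_crossings_le_loopLen (hc : c ∈ lowerBounds (X.crossingRatios k))
    (w : FreeGroup (Fin n)) : c * X.graph.crossings k w ≤ X.loopLen w := by
  obtain ⟨φ, hφ⟩ := exists_potential hc
  rw [crossings_eq_weight, loopLen_eq_weight]
  obtain ⟨v, hv⟩ := X.graph.geodesic_isPath w
  have hr := (X.graph.geodesic_isCyclicallyReduced w).append_self
  revert hv hr
  generalize X.graph.geodesic w = p
  intro hv hr
  by_cases hk : k ∈ p.map Prod.fst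
  · obtain ⟨⟨e, s⟩, ha, rfl⟩ := List.mem_map.1 hk
    obtain ⟨p₁, p₂, rfl⟩ := List.append_of_mem ha
    obtain ⟨x, h1, h2⟩ := FinGraph.isPath_append.1 hv
    -- The loop is cut open at one crossing, which serves as both ends of the piece, so the
    -- potentials cancel.
    have h3 := hφ (p₂ ++ p₁) s s (h2.2.append (h2.1 ▸ h1)) (hr.infix ⟨p₁, p₂, by simp⟩)
    simp only [weight_append, weight_cons, indicator_self] at h3 ⊢
    linarith
  · rw [weight_indicator_eq_zero hk, mul_zero]
    exact weight_nonneg X.len_nonneg p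

theorem exists_isLeast_crossingRatios {v : X.graph.V} {p : List (X.graph.E × Bool)}
    (hp : X.graph.IsSimpleClosedPath v p) (hk : k ∈ p.map Prod.fst) :
    ∃ c, 0 < c ∧ IsLeast (X.crossingRatios k) c := by
  obtain ⟨σ, hσ⟩ := exists_represents hp.2.1
  have h1 := IsSimpleLoop.crossings_eq hp hσ hk
  have hne : (X.crossingRatios k).Nonempty := ⟨_, σ, Or.inl ⟨_, _, hp, hσ⟩, by rw [h1]; norm_num, rfl⟩
  obtain ⟨c, hc, hmin⟩ := Set.exists_min_image _ id (X.finite_crossingRatios k) hne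
  refine ⟨c, ?_, hc, fun r hr => hmin r hr⟩
  obtain ⟨τ, -, hτ, rfl⟩ := hc
  refine div_pos (X.loopLen_pos ?_) (by exact_mod_cast hτ)
  rintro rfl
  simp [crossings, geodesic_one] at hτ

end MarkedMetricGraph

/-! ## Distances to points of a rose in which one petal gets short and another one long -/

namespace FreeGroup

theorem transLen_const_mul {α : Type*} (f : α → ℝ) (c : ℝ) (g : FreeGroup α) :
    transLen (fun a => c * f a) g = c * transLen f g := by
  classical
  unfold transLen
  simpa using weight_linear (f := f) f c 0 _

end FreeGroup

namespace MarkedGraph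

open FreeGroup

variable {n : ℕ} {R : MarkedGraph n} {e e₀ : R.E} {t : ℝ}

theorem ray_len_left (ht : 0 < t) : (R.ray e e₀ t).len e = t := by
  simp [ray, not_le.2 ht]

theorem ray_len_right (he : e ≠ e₀) (ht : 0 < t) : (R.ray e e₀ t).len e₀ = 1 / t := by
  simp [ray, not_le.2 ht, he.symm]

theorem ray_len_of_ne {a : R.E} (h : a ≠ e) (h' : a ≠ e₀) (ht : 0 < t) :
    (R.ray e e₀ t).len a = 1 := by
  simp [ray, not_le.2 ht, h, h']

theorem one_le_ray_len {a : R.E} (h : a ≠ e₀) (ht : 1 ≤ t) : 1 ≤ (R.ray e e₀ t).len a := by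
  have ht' : 0 < t := by linarith
  by_cases h' : a = e
  · rw [h', ray_len_left ht']; exact ht
  · rw [ray_len_of_ne h' h ht']

theorem ray_len_le_one {a : R.E} (h : a ≠ e) (ht : 1 ≤ t) : (R.ray e e₀ t).len a ≤ 1 := by
  have ht' : 0 < t := by linarith
  by_cases h' : a = e₀
  · subst h'
    rw [ray_len_right h.symm ht', div_le_one ht']; exact ht
  · rw [ray_len_of_ne h h' ht']

theorem IsPetalLoop.transLen_eq {γ : FreeGroup (Fin n)} (h : R.IsPetalLoop e₀ γ) {f : R.E → ℝ}
    (hf : ∀ a, 0 ≤ f a) : transLen f (R.mark γ) = f e₀ := by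
  rcases h with h | h
  · simpa using h.transLen_eq hf IsCyclicallyReduced.singleton
  · simpa using h.transLen_eq hf IsCyclicallyReduced.singleton

theorem IsPetalLoop.ne_one {γ : FreeGroup (Fin n)} (h : R.IsPetalLoop e₀ γ) : γ ≠ 1 := by
  rcases h with h | h
  · exact h.ne_one IsReduced.singleton (by simp)
  · exact h.ne_one IsReduced.singleton (by simp)

end MarkedGraph

namespace MarkedMetricGraph

open FreeGroup MarkedGraph

variable {n : ℕ} {X : MarkedMetricGraph n} {R : MarkedGraph n}
  {C : Collapse X.graph.toFinGraph R.toFinGraph} {γ : FreeGroup (Fin n)} {e e₀ : R.E}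

/-- The length of a petal loop is the length of the corresponding circle. -/
theorem loopLen_petal (hR : R.IsRose) (hC : Respects C) (hγ : R.IsPetalLoop e₀ γ) {v : X.graph.V}
    {c : List (X.graph.E × Bool)} (hc : X.graph.IsSimpleClosedPath v c)
    (h : C.hom (FreeGroup.mk c) = of e₀) : X.loopLen γ = weight X.len c := by
  rw [loopLen_eq_transLen]
  rcases hγ with hγ | hγ
  · exact Represents.transLen_eq ((hC.represents_iff hR hc.2.1 γ).2 (h ▸ hγ)) X.len_nonneg
      hc.isCyclicallyReduced
  · have h1 : X.graph.Represents (invRev c) γ := by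
      rw [hC.represents_iff hR hc.2.1.invRev, ← inv_mk, _root_.map_inv, h, ← mk_singleton_false]
      exact hγ
    rw [h1.transLen_eq X.len_nonneg, weight_invRev]
    refine isCyclicallyReduced_of_nodup ?_
    rw [map_fst_invRev, List.nodup_reverse]
    exact hc.2.2.2

/-- The petals are lifted to loops at a vertex of the circle of `γ`. The petal `e₀` lifts to the
circle itself, stretched from `1 / t` to `L_X(γ)`; the others have length at least one in `Y_t` and
lifts of length at most `M`, so for large `t` they are stretched no more. -/
theorem exists_loopLen_le (hR : R.IsRose) (hC : Respects C) (hγ : R.IsPetalLoop e₀ γ)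
    (he : e ≠ e₀) : ∃ M : ℝ, ∀ t : ℝ, 1 ≤ t → M ≤ t * X.loopLen γ → ∀ w,
      X.loopLen w ≤ t * X.loopLen γ * (R.ray e e₀ t).loopLen w := by
  classical
  have := R.finE
  obtain ⟨a, q, -, hcirc, -, -, hhom⟩ := hR.exists_circle C e₀ true
  obtain ⟨l, hl⟩ := hR.exists_lifts C (X.graph.start a)
  have hγlen := loopLen_petal hR hC hγ hcirc hhom
  set l' := Function.update l e₀ (a :: q) with hl'
  have hl1 : ∀ d, X.graph.IsPath (X.graph.start a) (l' d) (X.graph.start a) ∧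
      C.hom (FreeGroup.mk (l' d)) = of d := by
    intro d
    by_cases hd : d = e₀
    · subst hd; rw [hl', Function.update_self]; exact ⟨hcirc.2.1, hhom⟩
    · rw [hl', Function.update_of_ne hd]; exact ⟨(hl d).1, (hl d).2.1⟩
  obtain ⟨M, hM⟩ := (Set.finite_range fun d => weight X.len (l' d)).bddAbove
  refine ⟨M, fun t ht hMt w => ?_⟩
  have ht' : 0 < t := by linarith
  have hL : 0 < X.loopLen γ := X.loopLen_pos hγ.ne_one
  rw [loopLen_eq_transLen, ← transLen_eq_of_isConj X.len_nonneg (hC.isConj_lift hl1 w),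
    loopLen_eq_transLen (R.ray e e₀ t), ← transLen_const_mul]
  refine (transLen_map_le X.len_nonneg _ _).trans (transLen_mono (fun d => ?_) _)
  rw [lift_apply_of]
  refine (wordNorm_mk_le X.len_nonneg _).trans ?_
  by_cases hd : d = e₀
  · subst hd
    rw [ray_len_right he ht', hl', Function.update_self, ← hγlen]
    apply le_of_eq
    field_simp
  · have h1 := hM ⟨d, rfl⟩
    have h2 := one_le_ray_len (e := e) hd ht
    have h3 : 0 < t * X.loopLen γ := by positivity
    simp only at h1
    nlinarith

/-- Under the collapse only `k` becomes long; every other edge gets length at most one. Thus `K` can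
be a bound for the reciprocals of the edge lengths of `X`, independent of `t`. -/
theorem exists_loopLen_ray_le (hC : Respects C) {k : X.graph.E} {b : Bool}
    (hk : C.onE k = some (e, b)) (e₀ : R.E) : ∃ K : ℝ, ∀ t : ℝ, 1 ≤ t → ∀ w,
      (R.ray e e₀ t).loopLen w ≤ t * X.graph.crossings k w + K * X.loopLen w := by
  have := X.graph.finE
  obtain ⟨K, hK⟩ := (Set.finite_range fun d => (X.len d)⁻¹).bddAbove
  have hK' : ∀ d, 1 ≤ K * X.len d := fun d => by
    have h1 : (X.len d)⁻¹ ≤ K := hK ⟨d, rfl⟩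
    have h2 := X.len_pos d
    calc (1 : ℝ) = (X.len d)⁻¹ * X.len d := by field_simp
      _ ≤ K * X.len d := by gcongr
  refine ⟨K, fun t ht w => ?_⟩
  have ht' : 0 < t := by linarith
  have hlin : t * X.graph.crossings k w + K * X.loopLen w =
      transLen (fun d => t * indicator k d + K * X.len d) (X.graph.mark w) := by
    rw [crossings_eq_weight, loopLen_eq_weight]
    exact (weight_linear _ _ _ _).symm
  rw [hlin]
  obtain ⟨f, hf⟩ : ∃ f : R.E → ℝ, f = (R.ray e e₀ t).len := ⟨_, rfl⟩
  have hnn : ∀ a, 0 ≤ f a := hf ▸ (R.ray e e₀ t).len_nonneg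
  have hlen : (R.ray e e₀ t).loopLen w = transLen f (R.mark w) := by rw [hf]; rfl
  rw [hlen]
  refine (transLen_eq_of_isConj hnn (hC.isConj w)).symm.le.trans ?_
  refine (transLen_map_le hnn C.hom _).trans (transLen_mono (fun d => ?_) _)
  have h0 := indicator_nonneg k d
  rcases hd : C.onE d with _ | ⟨d', s⟩
  · rw [C.hom_of_none hd, wordNorm_one]
    have := hK' d
    positivity
  · rw [C.hom_of_some hd]
    refine (wordNorm_mk_le hnn _).trans ?_
    rw [weight_cons, weight_nil, add_zero]
    by_cases h : d' = e
    · subst h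
      obtain rfl := C.onE_inj hk hd
      simp only
      rw [hf, ray_len_left ht', indicator_self]
      linarith [hK' k]
    · have h1 := ray_len_le_one (e₀ := e₀) h ht
      have h2 : 0 ≤ t * indicator k d := by positivity
      rw [← hf] at h1
      simp only
      linarith [hK' d]

theorem stretch_le {Y : MarkedMetricGraph n} {m : ℝ} (hne : γ ≠ 1)
    (h : ∀ w, X.loopLen w ≤ m * Y.loopLen w) : X.stretch Y ≤ m := by
  have : Nonempty {w : FreeGroup (Fin n) // w ≠ 1} := ⟨⟨γ, hne⟩⟩
  refine ciSup_le fun w => ?_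
  rw [div_le_iff₀ (Y.loopLen_pos w.2)]
  exact h w

/-- The bound by `m` guarantees a true supremum: for an unbounded set the real supremum is zero by
convention. -/
theorem le_stretch {Y : MarkedMetricGraph n} {m : ℝ} (h : ∀ w, X.loopLen w ≤ m * Y.loopLen w)
    (hne : γ ≠ 1) : X.loopLen γ / Y.loopLen γ ≤ X.stretch Y := by
  refine le_ciSup (f := fun w : {w : FreeGroup (Fin n) // w ≠ 1} => X.loopLen w / Y.loopLen w)
    ⟨m, ?_⟩ ⟨γ, hne⟩
  rintro _ ⟨w, rfl⟩
  simp only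
  rw [div_le_iff₀ (Y.loopLen_pos w.2)]
  exact h w

theorem crossingRatios_eq (hR : R.IsRose) (hC : Respects C) {k : X.graph.E} {b : Bool}
    (hk : C.onE k = some (e, b)) :
    {r | ∃ σ : FreeGroup (Fin n), X.graph.IsAlmostSimpleLoop σ ∧
      0 < R.crossings e σ ∧ r = X.loopLen σ / R.crossings e σ} = X.crossingRatios k := by
  simp only [crossingRatios, hC.crossings_eq hR hk]

/-- For large `t` one factor is exactly `t * L_X(γ)`, attained at `γ`, and the other lies between `t
/ c` and `t / c + K`; dividing by `t ^ 2` squeezes the product. -/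
theorem tendsto_lipDist_ray (hR : R.IsRose) (hC : Respects C) (hγ : R.IsPetalLoop e₀ γ)
    (he : e ≠ e₀) {k : X.graph.E} {b : Bool} (hk : C.onE k = some (e, b)) {c : ℝ} (hc0 : 0 < c)
    (hc : IsLeast (X.crossingRatios k) c) :
    Tendsto (fun t : ℝ => Real.exp (X.lipDist (R.ray e e₀ t)) / t ^ 2) atTop
      (𝓝 (X.loopLen γ / c)) := by
  obtain ⟨M, hM⟩ := exists_loopLen_le hR hC hγ he
  obtain ⟨K, hK⟩ := exists_loopLen_ray_le hC hk e₀
  have hL : 0 < X.loopLen γ := X.loopLen_pos hγ.ne_one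
  have hev : ∀ᶠ t : ℝ in atTop, 1 / c * X.loopLen γ ≤
      Real.exp (X.lipDist (R.ray e e₀ t)) / t ^ 2 ∧
      Real.exp (X.lipDist (R.ray e e₀ t)) / t ^ 2 ≤ (1 / c + K * t⁻¹) * X.loopLen γ := by
    filter_upwards [eventually_ge_atTop 1, eventually_ge_atTop (M / X.loopLen γ)] with t ht htM
    rw [div_le_iff₀ hL] at htM
    have ht' : 0 < t := by linarith
    set Y := R.ray e e₀ t with hY
    have h1 := hM t ht htM
    have hYγ : Y.loopLen γ = 1 / t := by
      rw [← ray_len_right he ht']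
      exact hγ.transLen_eq (R.ray e e₀ t).len_nonneg
    have h2 : X.stretch Y = t * X.loopLen γ := by
      refine le_antisymm (stretch_le hγ.ne_one h1) ?_
      have := le_stretch h1 hγ.ne_one
      rw [hYγ] at this
      refine le_of_eq_of_le ?_ this
      field_simp
    have h3 : ∀ w, Y.loopLen w ≤ (t / c + K) * X.loopLen w := by
      intro w
      refine (hK t ht w).trans ?_
      have h4 := mul_crossings_le_loopLen hc.2 w
      have h5 : t * X.graph.crossings k w ≤ t / c * X.loopLen w := by
        rw [div_mul_eq_mul_div, le_div_iff₀ hc0]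
        nlinarith
      linarith
    have h4 := stretch_le hγ.ne_one h3
    -- The witness is an almost simple loop attaining the minimum; its crossings of `e` alone
    -- already have length `t` each.
    have h5 : t / c ≤ Y.stretch X := by
      obtain ⟨σ, -, hσ0, hσ⟩ := hc.1
      have hσ1 : σ ≠ 1 := by
        rintro rfl
        simp [crossings, geodesic_one] at hσ0
      refine le_trans ?_ (le_stretch h3 hσ1)
      have hLσ := X.loopLen_pos hσ1
      have hσ0' : (0 : ℝ) < X.graph.crossings k σ := by exact_mod_cast hσ0
      have h6 : t * X.graph.crossings k σ ≤ Y.loopLen σ := by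
        rw [← hC.crossings_eq hR hk, crossings_eq_transLen, ← transLen_const_mul]
        refine transLen_mono (fun d => ?_) _
        by_cases hd : d = e
        · subst hd
          rw [indicator_self, ray_len_left ht', mul_one]
        · rw [indicator_of_ne hd, mul_zero]
          exact (R.ray e e₀ t).len_nonneg d
      rw [le_div_iff₀ hLσ]
      refine le_trans (le_of_eq ?_) h6
      rw [hσ]
      field_simp
    have h6 : Real.exp (X.lipDist Y) = t * X.loopLen γ * Y.stretch X := by
      have h7 : 0 < Y.stretch X := lt_of_lt_of_le (by positivity) h5
      rw [lipDist, Real.exp_log (by rw [h2]; positivity), h2]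
    rw [h6]
    have h8 : t * X.loopLen γ * Y.stretch X / t ^ 2 = Y.stretch X / t * X.loopLen γ := by
      field_simp
    rw [h8]
    constructor
    · refine mul_le_mul_of_nonneg_right ?_ hL.le
      rw [le_div_iff₀ ht']
      refine le_of_eq_of_le ?_ h5
      ring
    · refine mul_le_mul_of_nonneg_right ?_ hL.le
      rw [div_le_iff₀ ht']
      refine h4.trans_eq ?_
      field_simp
  refine tendsto_of_tendsto_of_tendsto_of_le_of_le' (g := fun _ => 1 / c * X.loopLen γ)
    (h := fun t => (1 / c + K * t⁻¹) * X.loopLen γ) ?_ ?_ (hev.mono fun _ h => h.1)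
    (hev.mono fun _ h => h.2)
  · rw [show X.loopLen γ / c = 1 / c * X.loopLen γ by ring]
    exact tendsto_const_nhds
  · have : Tendsto (fun t : ℝ => (1 / c + K * t⁻¹) * X.loopLen γ) atTop
        (𝓝 ((1 / c + K * 0) * X.loopLen γ)) :=
      ((tendsto_inv_atTop_zero.const_mul K).const_add _).mul_const _
    convert this using 2
    ring

end MarkedMetricGraph

/-! ## Simple loops and petals of rose-faces -/

namespace MarkedGraph

open FreeGroup

variable {n : ℕ} {G H R : MarkedGraph n} {γ : FreeGroup (Fin n)}

theorem Respects.isPetalLoop {C : Collapse G.toFinGraph R.toFinGraph} (hC : Respects C)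
    {a : G.E × Bool} {q : List (G.E × Bool)} (hq : ∀ d ∈ q, C.onE d.1 = none) {e : R.E} {b : Bool}
    (ha : C.onE a.1 = some (e, b)) (hγ : G.Represents (a :: q) γ) : R.IsPetalLoop e γ := by
  have h := (C.hom.map_isConj hγ).trans (hC.isConj γ)
  obtain ⟨a, s⟩ := a
  rw [C.hom_mk_cons, C.hom_mk_of_collapsed hq, mul_one, C.hom_singleton_of_some ha] at h
  rcases hbs : (b == s) with _ | _
  · rw [hbs] at h; exact Or.inr h
  · rw [hbs] at h; exact Or.inl h

/-- The preimage of a petal closes up to a circle through collapsed edges, and a closed path is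
recognised up to conjugacy by its image in the rose. -/
theorem isSimpleLoop_of_petal (hR : R ∈ G.roseFaces) {e : R.E} (hγ : R.IsPetalLoop e γ) :
    G.IsSimpleLoop γ := by
  obtain ⟨hR, C, hC⟩ := hR
  have key : ∀ s, R.Represents [(e, s)] γ → G.IsSimpleLoop γ := by
    intro s h
    obtain ⟨a, q, b, hc, -, -, hhom⟩ := hR.exists_circle C e s
    exact ⟨_, _, hc, (hC.represents_iff hR hc.2.1 γ).2 (hhom ▸ h)⟩
  exact hγ.elim (key _) (key _)

/-- There is a spanning tree that contains all edges of a given circle but one. -/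
theorem exists_spanningTree_of_circle {v : G.V} {d : G.E × Bool} {p : List (G.E × Bool)}
    (hc : G.IsSimpleClosedPath v (d :: p)) :
    ∃ T, G.IsSpanningTree T ∧ (∀ b ∈ p, b.1 ∈ T) ∧ d.1 ∉ T := by
  obtain ⟨hp, hpn, -⟩ := hc.arc
  obtain ⟨T, hpT, hT⟩ := FinGraph.IsForest.exists_spanningTree (G := G.toFinGraph)
    (T₀ := {e | e ∈ p.map Prod.fst}) G.connected
    (fun x c' hc' hsub => hc'.not_subset_arc hp hpn hsub)
  have hpT' : ∀ b ∈ p, b.1 ∈ T := fun b hb => hpT (List.mem_map_of_mem hb)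
  exact ⟨T, hT, hpT', fun h => hT.1 _ _ hc fun b hb =>
    (List.mem_cons.1 hb).elim (fun hb => hb ▸ h) (hpT' b)⟩

/-- All edges of the circle but one lie in a spanning tree; collapsing it leaves that one edge as
the petal. -/
theorem exists_rose_petal (hn : 2 ≤ n) (h : G.IsSimpleLoop γ) :
    ∃ R ∈ G.roseFaces, ∃ e : R.E, R.IsPetalLoop e γ := by
  obtain ⟨v, c, hc, hγ⟩ := h
  obtain ⟨d, p, rfl⟩ := List.exists_cons_of_ne_nil hc.1
  obtain ⟨T, hT, hpT', hdT⟩ := exists_spanningTree_of_circle hc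
  obtain ⟨R, hR, C, hC, hCT⟩ := exists_rose hn hT
  obtain ⟨⟨e, b⟩, he⟩ := Option.ne_none_iff_exists'.1 (mt (hCT d.1).1 hdT)
  exact ⟨R, hR, e, hC.isPetalLoop (fun b hb => (hCT _).2 (hpT' b hb)) he hγ⟩

theorem isSimpleLoop_of_roseFaces_subset (hn : 2 ≤ n) (h : G.roseFaces ⊆ H.roseFaces)
    (hγ : G.IsSimpleLoop γ) : H.IsSimpleLoop γ := by
  obtain ⟨R, hR, e, he⟩ := exists_rose_petal hn hγ
  exact isSimpleLoop_of_petal (h hR) he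

/-- A property of loops which, for every rose-face, holds for all petals or for none, holds for all
simple loops or for none. -/
theorem IsSimpleLoop.induction (hn : 2 ≤ n) {P : FreeGroup (Fin n) → Prop}
    (hP : ∀ R ∈ G.roseFaces, ∀ e₀ e₁ : R.E, ∀ w₀ w₁, R.IsPetalLoop e₀ w₀ → R.IsPetalLoop e₁ w₁ →
      P w₀ → P w₁)
    {γ₀ : FreeGroup (Fin n)} (hγ₀ : G.IsSimpleLoop γ₀) (hPγ₀ : P γ₀) (hγ : G.IsSimpleLoop γ) :
    P γ := by
  classical
  set Good : Set G.E → Prop := fun T => ∀ v a q w, G.IsSimpleClosedPath v (a :: q) → a.1 ∉ T →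
    (∀ b ∈ q, b.1 ∈ T) → G.Represents (a :: q) w → P w with hGood
  have hgood : ∀ T, G.IsSpanningTree T → ∀ v a q w, G.IsSimpleClosedPath v (a :: q) → a.1 ∉ T →
      (∀ b ∈ q, b.1 ∈ T) → G.Represents (a :: q) w → P w → Good T := by
    intro T hT v a q w _ haT hqT hw hPw v' a' q' w' _ haT' hqT' hw'
    obtain ⟨R, hR, C, hC, hCT⟩ := exists_rose hn hT
    obtain ⟨⟨e, b⟩, he⟩ := Option.ne_none_iff_exists'.1 (mt (hCT a.1).1 haT)
    obtain ⟨⟨e', b'⟩, he'⟩ := Option.ne_none_iff_exists'.1 (mt (hCT a'.1).1 haT')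
    exact hP R hR e e' w w' (hC.isPetalLoop (fun b hb => (hCT _).2 (hqT b hb)) he hw)
      (hC.isPetalLoop (fun b hb => (hCT _).2 (hqT' b hb)) he' hw') hPw
  -- The induction is on the number of edges of `c` outside `T`. If there is only one, `c` is a
  -- petal of the rose of `T`; otherwise an edge exchange moves one edge of `c` into the tree.
  have hind : ∀ N T, G.IsSpanningTree T → Good T → ∀ v c, G.IsSimpleClosedPath v c →
      c.countP (fun a => decide (a.1 ∉ T)) ≤ N → G.Represents c γ → P γ := by
    intro N
    induction N with
    | zero =>
      intro T hT _ v c hc hN _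
      refine (hT.1 v c hc fun a ha => ?_).elim
      simpa using List.countP_eq_zero.1 (Nat.le_zero.1 hN) a ha
    | succ N ih =>
      intro T hT hTgood v c hc hN hcγ
      obtain ⟨a₀, ha₀, ha₀T⟩ : ∃ a ∈ c, a.1 ∉ T := by
        by_contra! h
        exact hT.1 v c hc h
      obtain ⟨a, q, haa, hc', hperm, hconj⟩ := hc.exists_edge_eq (List.mem_map_of_mem ha₀)
      have haT : a.1 ∉ T := by rw [haa]; exact ha₀T
      have hcγ' : G.Represents (a :: q) γ := hconj.symm.trans hcγ
      rw [hperm.countP_eq] at hN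
      by_cases hqT : ∀ b ∈ q, b.1 ∈ T
      · exact hTgood _ a q γ hc' haT hqT hcγ'
      push Not at hqT
      obtain ⟨b, hb, hbT⟩ := hqT
      -- the circle consisting of `a` and edges of the tree
      obtain ⟨r₀, hr₀, hr₀T⟩ := hT.2 (G.finish a) (G.start a)
      obtain ⟨r, hr, hrn, hrr⟩ := hr₀.exists_arc
      have hrT : ∀ d ∈ r, d.1 ∈ T := fun d hd => hr₀T d (hrr.subset hd)
      have har : G.IsSimpleClosedPath (G.start a) (a :: r) :=
        FinGraph.IsSimpleClosedPath.of_arc hr hrn fun h => by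
          obtain ⟨d, hd, hda⟩ := List.mem_map.1 h
          exact haT (hda ▸ hrT d hd)
      -- Otherwise the circle `a r` would lie in `a q` without the edge `b`, which is an arc: `b` is
      -- neither `a` nor in `T`.
      obtain ⟨x, hxr, hxq⟩ : ∃ x ∈ r.map Prod.fst, x ∉ (a :: q).map Prod.fst := by
        by_contra! hsub
        obtain ⟨b', q', hbb, hcb, hpermb, -⟩ :=
          hc'.exists_edge_eq (List.mem_map_of_mem (List.mem_cons_of_mem _ hb))
        obtain ⟨hq', hqn', -⟩ := hcb.arc
        have hba : a.1 ≠ b.1 := by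
          intro h
          have := hc'.2.2.2
          rw [List.map_cons, List.nodup_cons] at this
          exact this.1 (h ▸ List.mem_map_of_mem hb)
        refine har.not_subset_arc hq' hqn' fun d hd => ?_
        have h1 : d.1 ∈ (a :: q).map Prod.fst := by
          rcases List.mem_cons.1 hd with rfl | hd
          · exact List.mem_map_of_mem List.mem_cons_self
          · exact hsub _ (List.mem_map_of_mem hd)
        have h2 := (hpermb.map Prod.fst).subset h1
        rw [List.map_cons, List.mem_cons] at h2
        refine h2.resolve_left fun h3 => ?_
        rw [hbb] at h3
        rcases List.mem_cons.1 hd with rfl | hd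
        · exact hba h3
        · exact hbT (h3 ▸ hrT d hd)
      have hT' := hT.exchange har haT hrT hxr
      have hxT : x ∈ T := by
        obtain ⟨d, hd, rfl⟩ := List.mem_map.1 hxr
        exact hrT d hd
      have hxa : x ≠ a.1 := fun h => haT (h ▸ hxT)
      obtain ⟨w, hw⟩ := exists_represents har.2.1
      have hPw : P w := hTgood _ a r w har haT hrT hw
      obtain ⟨y, r', hyx, hyr, hpermy, hconjy⟩ :=
        har.exists_edge_eq (List.mem_cons_of_mem _ hxr)
      -- The circle `a r` is a petal for both trees: through `a` before the exchange, through `x`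
      -- after it. It carries the property from one rose to the next.
      have hT'good : Good (insert a.1 (T \ {x})) := by
        refine hgood _ hT' _ y r' w hyr ?_ ?_ (hconjy.symm.trans hw) hPw
        · rw [hyx]
          rintro (h | h)
          · exact hxa h
          · exact h.2 rfl
        · intro d hd
          have hdx : d.1 ≠ x := by
            intro h
            have := hyr.2.2.2
            rw [List.map_cons, List.nodup_cons, hyx] at this
            exact this.1 (h ▸ List.mem_map_of_mem hd)
          rcases List.mem_cons.1 (hpermy.symm.subset (List.mem_cons_of_mem _ hd)) with h | h
          · exact Or.inl (by rw [h])
          · exact Or.inr ⟨hrT d h, hdx⟩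
      have hle : (a :: q).countP (fun d => decide (d.1 ∉ insert a.1 (T \ {x}))) ≤ N := by
        rw [List.countP_cons_of_pos (by simpa using haT)] at hN
        rw [List.countP_cons_of_neg (by simp)]
        refine le_trans (List.countP_mono_left fun d hd h => ?_) (Nat.le_of_succ_le_succ hN)
        have hdx : d.1 ≠ x := fun h => hxq (h ▸ List.mem_map_of_mem (List.mem_cons_of_mem _ hd))
        simp only [decide_eq_true_eq] at h ⊢
        exact fun hdT => h (Or.inr ⟨hdT, hdx⟩)
      exact ih _ hT' hT'good _ _ hc' (by convert hle) hcγ'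
  obtain ⟨v₀, c₀, hc₀, hγc₀⟩ := hγ₀
  obtain ⟨d, p, rfl⟩ := List.exists_cons_of_ne_nil hc₀.1
  obtain ⟨T, hT, hpT, hdT⟩ := exists_spanningTree_of_circle hc₀
  obtain ⟨v, c, hc, hcγ⟩ := hγ
  exact hind _ T hT (hgood T hT _ _ _ _ hc₀ hdT hpT hγc₀ hPγ₀) v c hc le_rfl hcγ

/-! ### Loops modulo two -/

/-- The number of crossings of an edge modulo two is a homomorphism on the marking group, and a
circle crosses each edge at most once. -/
theorem IsSimpleLoop.perm_of_parity_eq {σ τ : FreeGroup (Fin n)} {u v : G.V}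
    {c d : List (G.E × Bool)} (hc : G.IsSimpleClosedPath u c) (hσ : G.Represents c σ)
    (hd : G.IsSimpleClosedPath v d) (hτ : G.Represents d τ) (h : ∀ i, parity i σ = parity i τ) :
    (c.map Prod.fst).Perm (d.map Prod.fst) := by
  classical
  rw [List.perm_iff_count]
  intro a
  have h1 := eq_of_parity_eq ((parity a).comp G.mark) h
  rw [MonoidHom.comp_apply, MonoidHom.comp_apply,
    ← isConj_iff_eq.1 ((parity a).map_isConj hσ), ← isConj_iff_eq.1 ((parity a).map_isConj hτ),
    parity_mk, parity_mk] at h1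
  have h2 := (ZMod.natCast_eq_natCast_iff' _ _ 2).1 (Multiplicative.ofAdd.injective h1)
  have h3 := List.nodup_iff_count_le_one.1 hc.2.2.2 a
  have h4 := List.nodup_iff_count_le_one.1 hd.2.2.2 a
  omega

/-- Simple loops with the same class modulo two cross the same edges. -/
theorem IsSimpleLoop.transLen_eq {σ τ : FreeGroup (Fin n)} (hσ : G.IsSimpleLoop σ)
    (hτ : G.IsSimpleLoop τ) (h : ∀ i, parity i σ = parity i τ) {f : G.E → ℝ}
    (hf : ∀ e, 0 ≤ f e) : transLen f (G.mark σ) = transLen f (G.mark τ) := by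
  obtain ⟨u, c, hc, hcσ⟩ := hσ
  obtain ⟨v, d, hd, hdτ⟩ := hτ
  rw [hcσ.transLen_eq hf hc.isCyclicallyReduced, hdτ.transLen_eq hf hd.isCyclicallyReduced]
  exact weight_congr_of_perm (IsSimpleLoop.perm_of_parity_eq hc hcσ hd hdτ h)

/-- A circle crosses some edge exactly once, so its class modulo two is nonzero. -/
theorem IsSimpleLoop.exists_parity_ne_one (h : G.IsSimpleLoop γ) : ∃ i, parity i γ ≠ 1 := by
  classical
  by_contra! h1
  obtain ⟨v, c, hc, hcγ⟩ := h
  obtain ⟨a, ha⟩ := List.exists_mem_of_ne_nil _ hc.1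
  have h2 := eq_of_parity_eq ((parity a.1).comp G.mark) (x := γ) (y := 1)
    (fun i => by rw [h1 i, _root_.map_one])
  rw [MonoidHom.comp_apply, ← isConj_iff_eq.1 ((parity a.1).map_isConj hcγ), parity_mk,
    List.count_eq_one_of_mem hc.2.2.2 (List.mem_map_of_mem ha), _root_.map_one] at h2
  exact absurd (Multiplicative.ofAdd.injective h2) (by decide)

/-- In rank two there are only three nontrivial classes modulo two. -/
theorem eq_of_three_classes {S : Set (FreeGroup (Fin 2))} {r : FreeGroup (Fin 2) → ℝ}
    (hS : ∀ σ ∈ S, ∃ i, parity i σ ≠ 1)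
    (hr : ∀ σ ∈ S, ∀ τ ∈ S, (∀ i, parity i σ = parity i τ) → r σ = r τ)
    (hup : ∀ σ ∈ S, ∃ τ ∈ S, (∃ i, parity i σ ≠ parity i τ) ∧ r σ ≤ r τ)
    (hdown : ∀ σ ∈ S, ∃ τ ∈ S, (∃ i, parity i σ ≠ parity i τ) ∧ r τ ≤ r σ)
    {x y : FreeGroup (Fin 2)} (hx : x ∈ S) (hy : y ∈ S) : r x ≤ r y := by
  by_contra! hlt
  -- Beyond two distinct nonzero vectors `a`, `b` of the plane over the field with two elements, the
  -- only other nonzero vector is `a + b`.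
  have three : ∀ a b c d : Fin 2 → Multiplicative (ZMod 2), (∃ i, a i ≠ 1) → (∃ i, b i ≠ 1) →
      (∃ i, c i ≠ 1) → (∃ i, d i ≠ 1) → (∃ i, a i ≠ b i) →
      (∀ i, a i = c i) ∨ (∀ i, b i = c i) ∨ (∀ i, a i = d i) ∨ (∀ i, b i = d i) ∨
      ∀ i, c i = d i := by
    have key : ∀ a b c : ZMod 2 × ZMod 2, a ≠ 0 → b ≠ 0 → c ≠ 0 → a ≠ b →
        a = c ∨ b = c ∨ c = a + b := by decide
    intro a b c d ha hb hc hd hab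
    have hne : ∀ f g : Fin 2 → Multiplicative (ZMod 2), (∃ i, f i ≠ g i) →
        ((f 0).toAdd, (f 1).toAdd) ≠ ((g 0).toAdd, (g 1).toAdd) := by
      rintro f g ⟨i, hi⟩ h
      rw [Prod.mk.injEq] at h
      fin_cases i
      · exact hi h.1
      · exact hi h.2
    have heq : ∀ f g : Fin 2 → Multiplicative (ZMod 2),
        ((f 0).toAdd, (f 1).toAdd) = ((g 0).toAdd, (g 1).toAdd) → ∀ i, f i = g i := by
      intro f g h
      by_contra! h'
      exact hne f g h' h
    have k1 := key _ _ _ (hne a 1 ha) (hne b 1 hb) (hne c 1 hc) (hne a b hab)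
    have k2 := key _ _ _ (hne a 1 ha) (hne b 1 hb) (hne d 1 hd) (hne a b hab)
    rcases k1 with h | h | h
    · exact Or.inl (heq _ _ h)
    · exact Or.inr (Or.inl (heq _ _ h))
    · rcases k2 with h' | h' | h'
      · exact Or.inr (Or.inr (Or.inl (heq _ _ h')))
      · exact Or.inr (Or.inr (Or.inr (Or.inl (heq _ _ h'))))
      · exact Or.inr (Or.inr (Or.inr (Or.inr (heq _ _ (h.trans h'.symm)))))
  obtain ⟨x', hx', hxx, hxr⟩ := hup x hx
  obtain ⟨y', hy', hyy, hyr⟩ := hdown y hy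
  have hxy : ∃ i, parity i x ≠ parity i y := by
    by_contra! h
    exact hlt.ne' (hr x hx y hy h)
  -- If `r y < r x`, then `x'` avoids the classes of `x` and `y`, and so does `y'`. Both are in the
  -- third class, so `r x' = r y'`, although `r y' ≤ r y < r x ≤ r x'`.
  rcases three (fun i => parity i x) (fun i => parity i y) (fun i => parity i x')
    (fun i => parity i y') (hS x hx) (hS y hy) (hS x' hx') (hS y' hy') hxy with h | h | h | h | h
  · exact hxx.elim fun i hi => hi (h i)
  · have := hr y hy x' hx' h
    linarith
  · have := hr x hx y' hy' h
    linarith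
  · exact hyy.elim fun i hi => hi (h i)
  · have := hr x' hx' y' hy' h
    linarith

end MarkedGraph

/-! ## Lengths of simple loops are determined by distances -/

namespace MarkedMetricGraph

open FreeGroup MarkedGraph

variable {n : ℕ} {X X₁ X₂ : MarkedMetricGraph n} {R : MarkedGraph n} {γ : FreeGroup (Fin n)}

/-- The ratios of length and number of crossings of a petal `e` of a rose, for the almost simple
loops that cross `e`. -/
def petalRatios (X : MarkedMetricGraph n) (R : MarkedGraph n) (e : R.E) : Set ℝ :=
  {r | ∃ σ : FreeGroup (Fin n), X.graph.IsAlmostSimpleLoop σ ∧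
    0 < R.crossings e σ ∧ r = X.loopLen σ / R.crossings e σ}

theorem exists_isLeast_petalRatios (X : MarkedMetricGraph n) (hR : R ∈ X.graph.roseFaces)
    (e : R.E) : ∃ c, 0 < c ∧ IsLeast (X.petalRatios R e) c ∧
      ∀ e₀ : R.E, e ≠ e₀ → ∀ γ, R.IsPetalLoop e₀ γ →
        Tendsto (fun t : ℝ => Real.exp (X.lipDist (R.ray e e₀ t)) / t ^ 2) atTop
          (𝓝 (X.loopLen γ / c)) := by
  obtain ⟨hR, C, hC⟩ := hR
  obtain ⟨a, q, b, hcirc, -, ha, -⟩ := hR.exists_circle C e true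
  obtain ⟨c, hc0, hc⟩ := exists_isLeast_crossingRatios hcirc (k := a.1) (by simp)
  refine ⟨c, hc0, ?_, fun e₀ he γ hγ => tendsto_lipDist_ray hR hC hγ he ha hc0 hc⟩
  rw [petalRatios, crossingRatios_eq hR hC ha]
  exact hc

/-- Both points have the same distances to the ray in the simplex of `R`, so the two limits `L / c`
agree. -/
theorem loopLen_mul_eq (hR₁ : R ∈ X₁.graph.roseFaces) (hR₂ : R ∈ X₂.graph.roseFaces)
    (hd : ∀ Y ∈ R.simplex, X₁.lipDist Y = X₂.lipDist Y) {e e₀ : R.E} (he : e ≠ e₀)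
    (hγ : R.IsPetalLoop e₀ γ) {c₁ c₂ : ℝ} (hc₁ : IsLeast (X₁.petalRatios R e) c₁)
    (hc₂ : IsLeast (X₂.petalRatios R e) c₂) : X₁.loopLen γ * c₂ = X₂.loopLen γ * c₁ := by
  obtain ⟨d₁, hd₁, hl₁, ht₁⟩ := X₁.exists_isLeast_petalRatios hR₁ e
  obtain ⟨d₂, hd₂, hl₂, ht₂⟩ := X₂.exists_isLeast_petalRatios hR₂ e
  obtain rfl := hc₁.unique hl₁
  obtain rfl := hc₂.unique hl₂
  have h1 := ht₁ e₀ he γ hγ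
  simp only [fun t => hd (R.ray e e₀ t) (Equivalent.refl R)] at h1
  have h2 := tendsto_nhds_unique h1 (ht₂ e₀ he γ hγ)
  rwa [div_eq_div_iff hd₁.ne' hd₂.ne'] at h2

/-! ### Rank at least three -/

/-- A third petal `e` gives the same factor `c₁ / c₂` for both loops. -/
theorem loopLen_eq_of_petals (hn : 3 ≤ n) (hR₁ : R ∈ X₁.graph.roseFaces)
    (hR₂ : R ∈ X₂.graph.roseFaces) (hd : ∀ Y ∈ R.simplex, X₁.lipDist Y = X₂.lipDist Y)
    {e₀ e₁ : R.E} {γ₀ γ₁ : FreeGroup (Fin n)} (h₀ : R.IsPetalLoop e₀ γ₀)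
    (h₁ : R.IsPetalLoop e₁ γ₁) (h : X₁.loopLen γ₀ = X₂.loopLen γ₀) :
    X₁.loopLen γ₁ = X₂.loopLen γ₁ := by
  classical
  have := R.finE
  have := Fintype.ofFinite R.E
  obtain ⟨e, he⟩ : ∃ e, e ∉ ({e₀, e₁} : Finset R.E) := by
    by_contra! hall
    have h1 := Finset.card_le_card (fun e _ => hall e : (Finset.univ : Finset R.E) ⊆ {e₀, e₁})
    have h2 := hR₁.1.card_edges
    rw [Nat.card_eq_fintype_card, ← Finset.card_univ] at h2
    have h3 := Finset.card_le_two (a := e₀) (b := e₁)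
    omega
  simp only [Finset.mem_insert, Finset.mem_singleton, not_or] at he
  obtain ⟨c₁, hc₁, hl₁, -⟩ := X₁.exists_isLeast_petalRatios hR₁ e
  obtain ⟨c₂, hc₂, hl₂, -⟩ := X₂.exists_isLeast_petalRatios hR₂ e
  have k₀ := loopLen_mul_eq hR₁ hR₂ hd he.1 h₀ hl₁ hl₂
  have k₁ := loopLen_mul_eq hR₁ hR₂ hd he.2 h₁ hl₁ hl₂
  rw [h] at k₀
  have hcc : c₂ = c₁ := mul_left_cancel₀ (X₂.loopLen_pos h₀.ne_one).ne' k₀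
  rw [hcc] at k₁
  exact mul_right_cancel₀ hc₁.ne' k₁

/-! ### Rank two -/

theorem le_loopLen_of_simple {e : R.E} {c : ℝ} (hc : IsLeast (X.petalRatios R e) c)
    {τ : FreeGroup (Fin n)} (hτ : X.graph.IsSimpleLoop τ) (h : R.crossings e τ = 1) :
    c ≤ X.loopLen τ :=
  hc.2 ⟨τ, Or.inl hτ, by rw [h]; norm_num, by rw [h]; norm_num⟩

/-- In rank two the minimal ratio of length and number of crossings of a petal is attained at a
simple loop. -/
theorem exists_simple_of_isLeast (hn : n = 2) (hR : R ∈ X.graph.roseFaces) {e : R.E} {c : ℝ}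
    (hc : IsLeast (X.petalRatios R e) c) :
    ∃ τ, X.graph.IsSimpleLoop τ ∧ R.crossings e τ = 1 ∧ X.loopLen τ ≤ c := by
  classical
  obtain ⟨hR, C, hC⟩ := hR
  have := R.finE
  have := Fintype.ofFinite R.E
  obtain ⟨k, b, hk⟩ := C.exists_onE_eq e
  obtain ⟨σ, hσ, hσ0, rfl⟩ := hc.1
  rw [hC.crossings_eq hR hk] at hσ0 ⊢
  have simple_case : ∀ v p τ, X.graph.IsSimpleClosedPath v p → X.graph.Represents p τ →
      k ∈ p.map Prod.fst → R.crossings e τ = 1 ∧ X.loopLen τ = weight X.len p := by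
    intro v p τ hp hτ hkp
    rw [hC.crossings_eq hR hk]
    exact ⟨IsSimpleLoop.crossings_eq hp hτ hkp,
      hτ.transLen_eq X.len_nonneg hp.isCyclicallyReduced⟩
  have hcast : (0 : ℝ) < X.graph.crossings k σ := by exact_mod_cast hσ0
  rcases hσ with ⟨v, p, hp, hpσ⟩ | ⟨u, v, α, s, β, hb, hbσ⟩
  · have hkp : k ∈ p.map Prod.fst := by
      by_contra hkp
      rw [crossings_eq_transLen, hpσ.transLen_eq (indicator_nonneg k) hp.isCyclicallyReduced,
        weight_indicator_eq_zero hkp] at hcast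
      exact hcast.false
    have h1 := IsSimpleLoop.crossings_eq hp hpσ hkp
    exact ⟨σ, ⟨v, p, hp, hpσ⟩, (simple_case v p σ hp hpσ hkp).1, by rw [h1]; simp⟩
  · obtain ⟨hα, hs, hβ, -, hed⟩ := hb
    have hred := isCyclicallyReduced_barbell hed hα.1 hβ.1
    rw [crossings_eq_transLen, hbσ.transLen_eq (indicator_nonneg k) hred] at hcast ⊢
    rw [loopLen_eq_transLen, hbσ.transLen_eq X.len_nonneg hred]
    simp only [weight_append, weight_invRev] at hcast ⊢
    have hed' := hed
    simp only [List.map_append] at hed'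
    obtain ⟨hed1, hed2, hed3⟩ := List.nodup_append.1 hed'
    obtain ⟨hed4, hed5, hed6⟩ := List.nodup_append.1 hed1
    have wα := weight_nonneg X.len_nonneg α
    have wβ := weight_nonneg X.len_nonneg β
    have ws := weight_nonneg X.len_nonneg s
    by_cases hkα : k ∈ α.map Prod.fst
    · obtain ⟨τ, hτ⟩ := exists_represents hα.2.1
      have h1 := simple_case _ _ _ hα hτ hkα
      refine ⟨τ, ⟨_, _, hα, hτ⟩, h1.1, ?_⟩
      -- The barbell crosses `k` only once, inside `α`, so `α` alone is a simple loop whose ratio is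
      -- no larger.
      rw [h1.2, weight_indicator_eq_one hα.2.2.2 hkα,
        weight_indicator_eq_zero fun h => hed6 k hkα k h rfl,
        weight_indicator_eq_zero fun h => hed3 k (List.mem_append_left _ hkα) k h rfl]
      norm_num
      linarith
    by_cases hkβ : k ∈ β.map Prod.fst
    · obtain ⟨τ, hτ⟩ := exists_represents hβ.2.1
      have h1 := simple_case _ _ _ hβ hτ hkβ
      refine ⟨τ, ⟨_, _, hβ, hτ⟩, h1.1, ?_⟩
      rw [h1.2, weight_indicator_eq_one hβ.2.2.2 hkβ, weight_indicator_eq_zero hkα,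
        weight_indicator_eq_zero fun h => hed3 k (List.mem_append_right _ h) k hkβ rfl]
      norm_num
      linarith
    -- the two circles of the barbell cannot both cross the only other petal
    exfalso
    -- Collapsed edges form a forest, so every circle contains an edge lying over some petal, and
    -- without `k` this petal is not `e`.
    have hcirc : ∀ v p, X.graph.IsSimpleClosedPath v p → k ∉ p.map Prod.fst →
        ∃ a ∈ p, ∃ e' t, C.onE a.1 = some (e', t) ∧ e' ≠ e := by
      intro v p hp hkp
      by_contra! hno
      refine hC.isForest v p hp fun a ha => ?_
      rcases ho : C.onE a.1 with _ | ⟨e', t⟩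
      · exact ho
      · have := hno a ha e' t ho
        subst this
        exact absurd (List.mem_map_of_mem ha) (C.onE_inj hk ho ▸ hkp)
    obtain ⟨a, ha, e₁, t₁, h1, hne1⟩ := hcirc _ _ hα hkα
    obtain ⟨a', ha', e₂, t₂, h2, hne2⟩ := hcirc _ _ hβ hkβ
    have h12 : e₁ = e₂ := by
      by_contra hne
      have h3 := hR.card_edges
      rw [Nat.card_eq_fintype_card, ← Finset.card_univ] at h3
      have h4 := Finset.card_le_card (Finset.subset_univ {e, e₁, e₂})
      rw [Finset.card_eq_three.2 ⟨e, e₁, e₂, hne1.symm, hne2.symm, hne, rfl⟩] at h4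
      omega
    subst h12
    exact hed3 a.1 (List.mem_append_left _ (List.mem_map_of_mem ha)) a'.1
      (List.mem_map_of_mem ha') (C.onE_inj h1 h2)

/-- In rank two, every simple loop is stretched at most as much as some simple loop in another class
modulo two. -/
theorem exists_stretched_more {X₁ X₂ : MarkedMetricGraph 2} {γ : FreeGroup (Fin 2)}
    (h12 : X₁.graph.roseFaces = X₂.graph.roseFaces)
    (hd : ∀ R ∈ X₁.graph.roseFaces, ∀ Y ∈ R.simplex, X₁.lipDist Y = X₂.lipDist Y)
    (hγ : X₁.graph.IsSimpleLoop γ) :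
    ∃ τ, X₁.graph.IsSimpleLoop τ ∧ (∃ i, parity i γ ≠ parity i τ) ∧
      X₁.loopLen γ / X₂.loopLen γ ≤ X₁.loopLen τ / X₂.loopLen τ := by
  obtain ⟨R, hR₁, e₀, he₀⟩ := exists_rose_petal le_rfl hγ
  have hR₂ := h12 ▸ hR₁
  have := R.finE
  have := Fintype.ofFinite R.E
  obtain ⟨e, he⟩ : ∃ e, e ≠ e₀ := by
    have h2 := hR₁.1.card_edges
    rw [Nat.card_eq_fintype_card] at h2
    have : Nontrivial R.E := Fintype.one_lt_card_iff_nontrivial.1 (by omega)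
    exact exists_ne e₀
  obtain ⟨c₁, hc₁, hl₁, -⟩ := X₁.exists_isLeast_petalRatios hR₁ e
  obtain ⟨c₂, hc₂, hl₂, -⟩ := X₂.exists_isLeast_petalRatios hR₂ e
  have hmul := loopLen_mul_eq hR₁ hR₂ (hd R hR₁) he he₀ hl₁ hl₂
  obtain ⟨τ, hτ, hτe, hτc⟩ := exists_simple_of_isLeast rfl hR₂ hl₂
  have hτ₁ : X₁.graph.IsSimpleLoop τ := isSimpleLoop_of_roseFaces_subset le_rfl h12.ge hτ
  refine ⟨τ, hτ₁, ?_, ?_⟩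
  -- The loop `γ` is the petal `e₀` and never crosses `e`, whereas `τ` crosses it once.
  · by_contra! hpar
    obtain ⟨hR, C, hC⟩ := hR₁
    obtain ⟨k, b, hk⟩ := C.exists_onE_eq e
    have h1 := hγ.transLen_eq hτ₁ hpar (indicator_nonneg k)
    rw [← crossings_eq_transLen, ← crossings_eq_transLen, ← hC.crossings_eq hR hk,
      ← hC.crossings_eq hR hk, hτe, crossings_eq_transLen,
      he₀.transLen_eq (indicator_nonneg e), indicator_of_ne he.symm] at h1
    norm_num at h1
  · have h1 := le_loopLen_of_simple hl₁ hτ₁ hτe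
    have p1 := X₁.loopLen_pos hγ.ne_one
    have p2 := X₂.loopLen_pos hγ.ne_one
    rw [div_le_div_iff₀ p2 (X₂.loopLen_pos hτ.ne_one)]
    calc X₁.loopLen γ * X₂.loopLen τ ≤ X₁.loopLen γ * c₂ := by gcongr
      _ = X₂.loopLen γ * c₁ := hmul
      _ ≤ X₂.loopLen γ * X₁.loopLen τ := by gcongr
      _ = X₁.loopLen τ * X₂.loopLen γ := mul_comm _ _

/-- Exchanging the roles of `X₁` and `X₂` turns the simple loop with larger ratio into one with
smaller ratio, so both hypotheses of the three-class argument hold. -/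
theorem loopLen_ratio_eq {X₁ X₂ : MarkedMetricGraph 2} {γ γ' : FreeGroup (Fin 2)}
    (h12 : X₁.graph.roseFaces = X₂.graph.roseFaces)
    (hd : ∀ R ∈ X₁.graph.roseFaces, ∀ Y ∈ R.simplex, X₁.lipDist Y = X₂.lipDist Y)
    (hγ : X₁.graph.IsSimpleLoop γ) (hγ' : X₁.graph.IsSimpleLoop γ') :
    X₁.loopLen γ / X₂.loopLen γ = X₁.loopLen γ' / X₂.loopLen γ' := by
  have h21 : ∀ {σ}, X₁.graph.IsSimpleLoop σ → X₂.graph.IsSimpleLoop σ :=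
    isSimpleLoop_of_roseFaces_subset le_rfl h12.le
  have h12' : ∀ {σ}, X₂.graph.IsSimpleLoop σ → X₁.graph.IsSimpleLoop σ :=
    isSimpleLoop_of_roseFaces_subset le_rfl h12.ge
  have key := fun {x y} => eq_of_three_classes (S := {σ | X₁.graph.IsSimpleLoop σ})
    (r := fun σ => X₁.loopLen σ / X₂.loopLen σ) (x := x) (y := y)
    (fun σ hσ => IsSimpleLoop.exists_parity_ne_one hσ)
    (fun σ hσ τ hτ h => by
      simp only [loopLen_eq_transLen]
      rw [IsSimpleLoop.transLen_eq hσ hτ h X₁.len_nonneg,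
        IsSimpleLoop.transLen_eq (h21 hσ) (h21 hτ) h X₂.len_nonneg])
    (fun σ hσ => exists_stretched_more h12 hd hσ)
    (fun σ hσ => by
      obtain ⟨τ, h1, h2, h3⟩ := exists_stretched_more h12.symm
        (fun R hR Y hY => (hd R (h12 ▸ hR) Y hY).symm) (h21 hσ)
      refine ⟨τ, h12' h1, h2, ?_⟩
      have hσ' := IsSimpleLoop.ne_one hσ
      rw [div_le_div_iff₀ (X₁.loopLen_pos hσ') (X₁.loopLen_pos h1.ne_one)] at h3
      rw [div_le_div_iff₀ (X₂.loopLen_pos h1.ne_one) (X₂.loopLen_pos hσ')]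
      linarith)
  exact le_antisymm (key hγ hγ') (key hγ' hγ)

end MarkedMetricGraph

/-! ### Assembly of the three claims -/

theorem proposition6 (n : ℕ) (hn : 2 ≤ n) (G₁ G₂ : MarkedGraph n)
    (hG : G₁.roseFaces = G₂.roseFaces) :
    -- the two simplices have the same simple loops
    (∀ γ : FreeGroup (Fin n), G₁.IsSimpleLoop γ ↔ G₂.IsSimpleLoop γ) ∧
    -- distances from the common rose-faces determine the lengths of simple loops
    (∀ X₁ ∈ G₁.simplex ∪ G₂.simplex, ∀ X₂ ∈ G₁.simplex ∪ G₂.simplex,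
      (∀ R ∈ G₁.roseFaces, ∀ Y ∈ R.simplex, X₁.lipDist Y = X₂.lipDist Y) →
      ∀ γ₀ : FreeGroup (Fin n), G₁.IsSimpleLoop γ₀ →
        X₁.loopLen γ₀ = 1 → X₂.loopLen γ₀ = 1 →
        ∀ γ : FreeGroup (Fin n), G₁.IsSimpleLoop γ → X₁.loopLen γ = X₂.loopLen γ) ∧
    -- every simple loop is a petal of a common rose-face, and its length is recovered from the
    -- distances to the ray `Y_t`, up to a factor `C` depending only on the point and on `e`
    (∀ γ : FreeGroup (Fin n), G₁.IsSimpleLoop γ →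
      (∃ R ∈ G₁.roseFaces, ∃ e₀ : R.E, R.IsPetalLoop e₀ γ) ∧
      ∀ R ∈ G₁.roseFaces, ∀ e₀ : R.E, R.IsPetalLoop e₀ γ → ∀ e : R.E, e ≠ e₀ →
        ∀ X ∈ G₁.simplex ∪ G₂.simplex, ∃ C l : ℝ, 0 < C ∧
          IsLeast {r | ∃ σ : FreeGroup (Fin n), X.graph.IsAlmostSimpleLoop σ ∧
            0 < R.crossings e σ ∧ r = X.loopLen σ / R.crossings e σ} C ∧
          Tendsto (fun t : ℝ => Real.exp (X.lipDist (R.ray e e₀ t)) / t ^ 2) atTop (𝓝 l) ∧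
          X.loopLen γ = C * l) := by
  have hX : ∀ X ∈ G₁.simplex ∪ G₂.simplex, X.graph.roseFaces = G₁.roseFaces := by
    rintro X (hX | hX)
    · exact MarkedGraph.Equivalent.roseFaces_eq hX
    · exact (MarkedGraph.Equivalent.roseFaces_eq hX).trans hG.symm
  refine ⟨fun γ => ⟨MarkedGraph.isSimpleLoop_of_roseFaces_subset hn hG.le,
    MarkedGraph.isSimpleLoop_of_roseFaces_subset hn hG.ge⟩, ?_, fun γ hγ =>
    ⟨MarkedGraph.exists_rose_petal hn hγ, ?_⟩⟩
  · intro X₁ hX₁ X₂ hX₂ hd γ₀ hγ₀ h₁ h₂ γ hγ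
    -- In rank two a rose offers no petal besides the two to be compared, so the argument through
    -- classes modulo two replaces the induction over roses.
    rcases hn.eq_or_lt with rfl | hn3
    · have h12 := (hX X₁ hX₁).trans (hX X₂ hX₂).symm
      have hs : ∀ {σ}, G₁.IsSimpleLoop σ → X₁.graph.IsSimpleLoop σ :=
        MarkedGraph.isSimpleLoop_of_roseFaces_subset le_rfl (hX X₁ hX₁).ge
      have h := MarkedMetricGraph.loopLen_ratio_eq h12 (fun R hR => hd R (hX X₁ hX₁ ▸ hR))
        (hs hγ) (hs hγ₀)
      rw [h₁, h₂, div_one, div_eq_one_iff_eq (X₂.loopLen_pos hγ.ne_one).ne'] at h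
      exact h
    · refine MarkedGraph.IsSimpleLoop.induction hn
        (P := fun σ => X₁.loopLen σ = X₂.loopLen σ) ?_ hγ₀ (h₁.trans h₂.symm) hγ
      intro R hR e₀ e₁ w₀ w₁ hw₀ hw₁ h
      exact MarkedMetricGraph.loopLen_eq_of_petals hn3 (hX X₁ hX₁ ▸ hR) (hX X₂ hX₂ ▸ hR) (hd R hR)
        hw₀ hw₁ h
  · intro R hR e₀ hγ₀ e he X hXm
    obtain ⟨c, hc0, hc, ht⟩ := X.exists_isLeast_petalRatios (hX X hXm ▸ hR) e
    exact ⟨c, X.loopLen γ / c, hc0, hc, ht e₀ he γ hγ₀, by field_simp⟩
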